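/- Let $d\ge 2$, let $M\in GL_d(\mathbb Z)$, and let $\rho(M)$ denote the maximum of the spectral radii of $M$ and $M^{-1}$. Let $m>0$ be a real number and put $$A_m=\{w\in\mathbb C : 1<|w|<e^m\},\qquad S_m=\{w\in\mathbb C : |\operatorname{Im} w|<\tfrac{m}{4\pi}\}.$$ Let $\mathbb Z$ act on $(\mathbb C^*)^d$ so that $j\in\mathbb Z$ sends $z$ to the point $j.z$ with coordinates $(j.z)_i=\prod_{k} z_k^{(M^j)_{ik}}$, and on $S_m\times(\mathbb C^*)^d$ by $j.(w,z)=(w+j,\,j.z)$. This action is free and properly discontinuous; let $E_m=E_m((\mathbb C^*)^d,M)=(S_m\times(\mathbb C^*)^d)/\mathbb Z$ be the quotient complex manifold and let $p:E_m\to A_m$, $p[w,z]=e^{m/2+2\pi i w}$, be the fibration map induced by the projection $S_m\times(\mathbb C^*)^d\to S_m$ and the universal covering $S_m\to A_m$. If $\rho(M)>1$, the characteristic polynomial of $M$ is irreducible over $\mathbb Z$, and $m\log\rho(M)>2\pi^2$, then $p$ induces an isomorphism $g\mapsto g\circ p$ from the algebra $\mathcal O(A_m)$ of holomorphic functions on $A_m$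 onto the algebra $\mathcal O(E_m)$ of holomorphic functions on $E_m$. In particular, every holomorphic function on $E_m$ is the pullback under $p$ of a unique holomorphic function on $A_m$. -/

import Mathlib

open scoped Manifold ContDiff

noncomputable section

namespace FlatBundle

/-- The monomial map `z ↦ (∏ₖ zₖ ^ Aᵢₖ)ᵢ` of an integral matrix `A`. -/
def monomialMap {d : ℕ} (A : Matrix (Fin d) (Fin d) ℤ) (z : Fin d → ℂ) : Fin d → ℂ :=
  fun i => ∏ k, z k ^ A i k

lemma monomialMap_ne_zero {d : ℕ} (A : Matrix (Fin d) (Fin d) ℤ) {z : Fin d → ℂ}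
    (hz : ∀ i, z i ≠ 0) (i : Fin d) : monomialMap A z i ≠ 0 :=
  Finset.prod_ne_zero_iff.2 fun k _ => zpow_ne_zero _ (hz k)

lemma monomialMap_one {d : ℕ} (z : Fin d → ℂ) : monomialMap 1 z = z := by
  funext i
  unfold monomialMap
  rw [Finset.prod_eq_single i]
  · simp
  · intro k _ hk
    simp [Matrix.one_apply_ne hk.symm]
  · simp

lemma monomialMap_mul {d : ℕ} (A B : Matrix (Fin d) (Fin d) ℤ) {z : Fin d → ℂ}
    (hz : ∀ i, z i ≠ 0) : monomialMap (A * B) z = monomialMap A (monomialMap B z) := by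
  funext i
  have h1 : ∀ k, z k ^ (A * B) i k = ∏ l, (z k ^ B l k) ^ A i l := by
    intro k
    rw [Matrix.mul_apply]
    have : ∀ s : Finset (Fin d), z k ^ (∑ l ∈ s, A i l * B l k) =
        ∏ l ∈ s, (z k ^ B l k) ^ A i l := by
      intro s
      induction s using Finset.induction_on with
      | empty => simp
      | insert a s ha ih =>
        rw [Finset.sum_insert ha, Finset.prod_insert ha, zpow_add₀ (hz k), ih, mul_comm (A i a),
          zpow_mul]
    exact this _
  unfold monomialMap
  simp_rw [h1, ← Finset.prod_zpow]
  exact Finset.prod_comm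

/-- The annulus `A_m = {w ∈ ℂ | 1 < |w| < e^m}`. -/
def annulus (m : ℝ) : TopologicalSpace.Opens ℂ :=
  ⟨{w | 1 < ‖w‖ ∧ ‖w‖ < Real.exp m},
    (isOpen_lt continuous_const continuous_norm).inter
      (isOpen_lt continuous_norm continuous_const)⟩

/-- The domain `S_m × (ℂ*)^d` in `ℂ × ℂ^d`, where `S_m = {w ∈ ℂ | |Im w| < m / (4π)}`. -/
def stripProd (m : ℝ) (d : ℕ) : TopologicalSpace.Opens (ℂ × (Fin d → ℂ)) :=
  ⟨{x | |x.1.im| < m / (4 * Real.pi) ∧ ∀ i, x.2 i ≠ 0}, by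
    have h1 : IsOpen {x : ℂ × (Fin d → ℂ) | |x.1.im| < m / (4 * Real.pi)} :=
      isOpen_lt (by fun_prop) continuous_const
    have h2 : IsOpen {x : ℂ × (Fin d → ℂ) | ∀ i, x.2 i ≠ 0} := by
      simp only [Set.ofPred_forall]
      exact isOpen_iInter_of_finite fun i => isOpen_ne_fun (by fun_prop) continuous_const
    exact h1.inter h2⟩

/-- The complex manifold `S_m × (ℂ*)^d`, tagged with the matrix `M` that governs the
`ℤ`-action. -/
def Cover {d : ℕ} (m : ℝ) (_M : Matrix.GeneralLinearGroup (Fin d) ℤ) : Type :=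
  stripProd m d

section

variable {d : ℕ} (m : ℝ) (M : Matrix.GeneralLinearGroup (Fin d) ℤ)

instance : TopologicalSpace (Cover m M) := inferInstanceAs (TopologicalSpace (stripProd m d))

instance : T2Space (Cover m M) := inferInstanceAs (T2Space (stripProd m d))

instance : LocallyCompactSpace (Cover m M) :=
  (stripProd m d).isOpen.locallyCompactSpace

instance : ChartedSpace (ℂ × (Fin d → ℂ)) (Cover m M) :=
  inferInstanceAs (ChartedSpace (ℂ × (Fin d → ℂ)) (stripProd m d))

instance : IsManifold 𝓘(ℂ, ℂ × (Fin d → ℂ)) ω (Cover m M) :=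
  inferInstanceAs (IsManifold 𝓘(ℂ, ℂ × (Fin d → ℂ)) ω (stripProd m d))

variable {m M}

/-- The diagonal action `j.(w, z) = (w + j, j.z)` of `ℤ` on `S_m × (ℂ*)^d`, where `j.z` is the
image of `z` under the monomial map of `M ^ j`. -/
instance : AddAction ℤ (Cover m M) where
  vadd j x := ⟨(x.1.1 + (j : ℂ),
      monomialMap ((M ^ j : Matrix.GeneralLinearGroup (Fin d) ℤ) : Matrix (Fin d) (Fin d) ℤ)
        x.1.2),
    ⟨by simpa using x.2.1, monomialMap_ne_zero _ x.2.2⟩⟩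
  zero_vadd x := Subtype.ext (Prod.ext
    (show x.1.1 + ((0 : ℤ) : ℂ) = x.1.1 by simp)
    (show monomialMap ((M ^ (0 : ℤ) : Matrix.GeneralLinearGroup (Fin d) ℤ) :
        Matrix (Fin d) (Fin d) ℤ) x.1.2 = x.1.2 by simp [monomialMap_one]))
  add_vadd j l x := Subtype.ext (Prod.ext
    (show x.1.1 + ((j + l : ℤ) : ℂ) = x.1.1 + (l : ℂ) + (j : ℂ) by push_cast; ring)
    (show monomialMap ((M ^ (j + l) : Matrix.GeneralLinearGroup (Fin d) ℤ) :
        Matrix (Fin d) (Fin d) ℤ) x.1.2 = monomialMap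
          ((M ^ j : Matrix.GeneralLinearGroup (Fin d) ℤ) : Matrix (Fin d) (Fin d) ℤ)
          (monomialMap ((M ^ l : Matrix.GeneralLinearGroup (Fin d) ℤ) :
            Matrix (Fin d) (Fin d) ℤ) x.1.2) by
      rw [← monomialMap_mul _ _ x.2.2, zpow_add, Units.val_mul]))

lemma vadd_fst (j : ℤ) (x : Cover m M) : (j +ᵥ x).1.1 = x.1.1 + (j : ℂ) := rfl

lemma vadd_snd (j : ℤ) (x : Cover m M) : (j +ᵥ x).1.2 =
    monomialMap ((M ^ j : Matrix.GeneralLinearGroup (Fin d) ℤ) : Matrix (Fin d) (Fin d) ℤ)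
      x.1.2 := rfl

lemma continuous_val : Continuous (fun x : Cover m M => x.1) := continuous_subtype_val

instance : IsCancelVAdd ℤ (Cover m M) where
  right_cancel' j l x h := by
    have h1 : x.1.1 + (j : ℂ) = x.1.1 + (l : ℂ) := by
      rw [← vadd_fst, ← vadd_fst, h]
    exact_mod_cast add_left_cancel h1

instance : ContinuousConstVAdd ℤ (Cover m M) where
  continuous_const_vadd j := by
    refine Continuous.subtype_mk (Continuous.prodMk ?_ ?_) _
    · exact (continuous_fst.comp continuous_val).add continuous_const
    · refine continuous_pi fun i => continuous_finsetProd _ fun k _ => ?_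
      exact ((continuous_apply k).comp (continuous_snd.comp continuous_val)).zpow₀ _
        fun x => Or.inl (x.2.2 k)

instance : ProperlyDiscontinuousVAdd ℤ (Cover m M) where
  finite_disjoint_inter_image {K L} hK hL := by
    have hre : Continuous (fun x : Cover m M => x.1.1.re) :=
      Complex.continuous_re.comp (continuous_fst.comp continuous_val)
    obtain ⟨a, ha⟩ := (hK.image hre).isBounded.exists_norm_le
    obtain ⟨b, hb⟩ := (hL.image hre).isBounded.exists_norm_le
    refine (Set.finite_Icc (-⌈a + b⌉) ⌈a + b⌉).subset ?_
    rintro j ⟨_, ⟨x, hx, rfl⟩, hy⟩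
    have h1 := ha _ ⟨x, hx, rfl⟩
    have h2 := hb _ ⟨_, hy, rfl⟩
    simp only [vadd_fst, Complex.add_re, Complex.intCast_re, Real.norm_eq_abs, abs_le] at h1 h2
    have h3 := Int.le_ceil (a + b)
    constructor
    · have : (-⌈a + b⌉ : ℝ) ≤ j := by linarith
      exact_mod_cast this
    · have : (j : ℝ) ≤ ⌈a + b⌉ := by linarith
      exact_mod_cast this

end

/-- The quotient manifold `E_m = E_m((ℂ*)^d, M) = (S_m × (ℂ*)^d) / ℤ`. Its topology is the quotient
topology; its charts are the local inverses of the covering map `S_m × (ℂ*)^d → E_m`. -/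
abbrev Total {d : ℕ} (m : ℝ) (M : Matrix.GeneralLinearGroup (Fin d) ℤ) : Type :=
  AddAction.orbitRel.Quotient ℤ (Cover m M)

/-- The universal covering `w ↦ exp(m/2 + 2πiw)` of `A_m` by `S_m`, composed with the projection
`S_m × (ℂ*)^d → S_m`. -/
def coverProj {d : ℕ} (m : ℝ) (M : Matrix.GeneralLinearGroup (Fin d) ℤ) (x : Cover m M) :
    annulus m :=
  ⟨Complex.exp (m / 2 + 2 * Real.pi * Complex.I * x.1.1), by
    have h := abs_lt.1 x.2.1
    have hpi := Real.pi_pos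
    have h1 : 2 * Real.pi * (m / (4 * Real.pi)) = m / 2 := by field_simp; ring
    have h2 : 2 * Real.pi * x.1.1.im < m / 2 := by
      rw [← h1]; exact mul_lt_mul_of_pos_left h.2 (by positivity)
    have h3 : -(m / 2) < 2 * Real.pi * x.1.1.im := by
      rw [← h1, ← mul_neg]; exact mul_lt_mul_of_pos_left h.1 (by positivity)
    have h4 : (m / 2 + 2 * Real.pi * Complex.I * x.1.1 : ℂ).re =
        m / 2 - 2 * Real.pi * x.1.1.im := by
      simp [Complex.add_re, Complex.mul_re, Complex.mul_im]
      norm_cast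
    constructor
    · rw [Complex.norm_exp, h4, Real.one_lt_exp_iff]; linarith
    · rw [Complex.norm_exp, h4, Real.exp_lt_exp]; linarith⟩

/-- The fibration map `p : E_m → A_m`, `[w, z] ↦ exp(m/2 + 2πiw)`. -/
def proj {d : ℕ} (m : ℝ) (M : Matrix.GeneralLinearGroup (Fin d) ℤ) : Total m M → annulus m :=
  Quotient.lift (coverProj m M) (by
    rintro _ y ⟨j, rfl⟩
    refine Subtype.ext ?_
    change Complex.exp (m / 2 + 2 * Real.pi * Complex.I * (y.1.1 + (j : ℂ))) =
      Complex.exp (m / 2 + 2 * Real.pi * Complex.I * y.1.1)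
    rw [Complex.exp_eq_exp_iff_exists_int]
    exact ⟨j, by ring⟩)

/-- On `{z | ∀ i, zᵢ ≠ 0}`, the map `(w, z) ↦ (w + c, monomialMap A z)` is holomorphic. -/
lemma contDiffAt_translate_monomialMap {d : ℕ} (c : ℂ) (A : Matrix (Fin d) (Fin d) ℤ)
    {v : ℂ × (Fin d → ℂ)} (hv : ∀ i, v.2 i ≠ 0) :
    ContDiffAt ℂ ω (fun u : ℂ × (Fin d → ℂ) => (u.1 + c, monomialMap A u.2)) v := by
  refine ContDiffAt.prodMk (contDiffAt_fst.add contDiffAt_const) ?_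
  refine contDiffAt_pi.2 fun i => ?_
  unfold monomialMap
  refine contDiffAt_prod fun k _ => ?_
  have hk : ContDiffAt ℂ ω (fun u : ℂ × (Fin d → ℂ) => u.2 k) v :=
    (contDiff_apply ℂ ℂ k).contDiffAt.comp v contDiffAt_snd
  cases A i k with
  | ofNat n => simpa using hk.pow n
  | negSucc n =>
    simp only [zpow_negSucc]
    exact (hk.pow (n + 1)).inv (pow_ne_zero _ (hv k))

/-- The quotient `E_m` is a complex manifold. -/
instance {d : ℕ} (m : ℝ) (M : Matrix.GeneralLinearGroup (Fin d) ℤ) :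
    IsManifold 𝓘(ℂ, ℂ × (Fin d → ℂ)) ω (Total m M) := by
  apply isManifold_of_contDiffOn
  rintro _ _ ⟨q, rfl⟩ ⟨q', rfl⟩
  generalize_proofs hf hg
  generalize hg.choose q = a
  generalize hg.choose q' = b
  set ca := chartAt (ℂ × (Fin d → ℂ)) a with hca
  set cb := chartAt (ℂ × (Fin d → ℂ)) b with hcb
  have hcb' : ∀ x, cb x = x.1 := fun x => rfl
  have hca' : ∀ v ∈ ca.target, (ca.symm v).1 = v := fun v hv => ca.right_inv hv
  simp only [modelWithCornersSelf_coe, modelWithCornersSelf_coe_symm, Set.range_id, Set.inter_univ,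
    Function.id_comp, Function.comp_id, Set.preimage_id]
  set T := ((hf.localInverseAt a).trans ca).symm.trans ((hf.localInverseAt b).trans cb) with hT
  intro v hv
  refine ContDiffAt.contDiffWithinAt ?_
  have key : ∀ u ∈ T.source, u ∈ ca.target ∧
      (Quotient.mk _ (ca.symm u) : Total m M) ∈ (hf.localInverseAt b).source ∧
      T u = ((hf.localInverseAt b) (Quotient.mk _ (ca.symm u) : Total m M)).1 := by
    intro u hu
    simp only [hT, OpenPartialHomeomorph.trans_source, OpenPartialHomeomorph.trans_symm_eq_symm_trans_symm,
      OpenPartialHomeomorph.symm_source, Set.mem_inter_iff, Set.mem_preimage,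
      OpenPartialHomeomorph.coe_trans, Function.comp_apply, hf.localInverseAt_symm] at hu ⊢
    exact ⟨hu.1.1, hu.2.1, rfl⟩
  obtain ⟨hv1, hv2, hv3⟩ := key v hv
  set y := (hf.localInverseAt b) (Quotient.mk _ (ca.symm v) : Total m M) with hy
  have hyb : y ∈ (hf.localInverseAt b).target := (hf.localInverseAt b).map_source hv2
  have hyq := hf.apply_localInverseAt_of_mem hv2
  obtain ⟨j, hj⟩ : ∃ j : ℤ, j +ᵥ ca.symm v = y := by
    have := Quotient.exact hyq
    exact this
  have hev : ∀ᶠ u in nhds v, u ∈ T.source ∧ (j +ᵥ ca.symm u) ∈ (hf.localInverseAt b).target := by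
    refine Filter.Eventually.and (T.open_source.mem_nhds hv) ?_
    have hc : ContinuousAt (fun u => j +ᵥ ca.symm u) v :=
      (continuous_const_vadd j).continuousAt.comp (ca.symm.continuousAt hv1)
    exact hc.eventually ((hf.localInverseAt b).open_target.mem_nhds (by simpa only [hj] using hyb))
  have hvne : ∀ i, v.2 i ≠ 0 := by
    rw [← hca' v hv1]
    exact (ca.symm v).2.2
  refine (contDiffAt_translate_monomialMap (j : ℂ)
    ((M ^ j : Matrix.GeneralLinearGroup (Fin d) ℤ) : Matrix (Fin d) (Fin d) ℤ)
    hvne).congr_of_eventuallyEq ?_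
  filter_upwards [hev] with u hu
  obtain ⟨hu1, hu2, hu3⟩ := key u hu.1
  have h1 : (hf.localInverseAt b) (Quotient.mk _ (ca.symm u) : Total m M) = j +ᵥ ca.symm u := by
    refine hf.injOn_localInverseAt_target ((hf.localInverseAt b).map_source hu2) hu.2 ?_
    rw [hf.apply_localInverseAt_of_mem hu2]
    exact (Quotient.sound ⟨j, rfl⟩ : (Quotient.mk _ (j +ᵥ ca.symm u) : Total m M) =
      Quotient.mk _ (ca.symm u)).symm
  change T u = _
  rw [hu3, h1]
  refine Prod.ext ?_ ?_
  · rw [vadd_fst, hca' u hu1]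
  · rw [vadd_snd, hca' u hu1]

/-- The algebra `𝒪(X)` of holomorphic functions on a complex manifold `X` modelled on `V`. -/
def holomorphicFunctions (V : Type*) [NormedAddCommGroup V] [NormedSpace ℂ V]
    (X : Type*) [TopologicalSpace X] [ChartedSpace V X] : Subalgebra ℂ (X → ℂ) where
  carrier := {f | MDifferentiable 𝓘(ℂ, V) 𝓘(ℂ, ℂ) f}
  mul_mem' hf hg := hf.mul hg
  add_mem' hf hg := hf.add hg
  algebraMap_mem' _ := mdifferentiable_const

/-- `ρ(M)`, the maximum of the spectral radii of `M` and `M⁻¹`. -/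
def rho {d : ℕ} (M : Matrix.GeneralLinearGroup (Fin d) ℤ) : ℝ :=
  max (spectralRadius ℂ ((M : Matrix (Fin d) (Fin d) ℤ).map (Int.cast : ℤ → ℂ))).toReal
    (spectralRadius ℂ (((M⁻¹ : Matrix.GeneralLinearGroup (Fin d) ℤ) :
      Matrix (Fin d) (Fin d) ℤ).map (Int.cast : ℤ → ℂ))).toReal

end FlatBundle

end

/-!
# Holomorphic functions on flat `(ℂ*)^d`-bundles over annuli

A holomorphic function on `E_m` is a holomorphic function `F` on `S_m × (ℂ*)^d` with
`F (w + 1, M.z) = F (w, z)`. In the Laurent expansion `F (w, z) = ∑ a_α(w) z^α` the invariance reads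
`a_α (w + 1) = a_{Mᵀα} (w)`, so that the values of a single coefficient `a_α` at `w + j` are the
values at `w` of the coefficients along the orbit of `α` under `Mᵀ`.

Laurent coefficients of `F (w, ·)` decay faster than every exponential in the size of the exponent,
locally uniformly in `w` (`exists_norm_laurentTerm_one_le`). Let `μ` be an eigenvalue of `M` or of
`M⁻¹` of modulus `ρ(M)`, with eigenvector `v`. As the characteristic polynomial is irreducible,
`v` is not orthogonal to any nonzero integral vector `α` (`sum_mul_eigenvector_ne_zero`); pairing
the orbit of `α` with `v` shows that it grows at least like `ρ(M) ^ j` in one of the two directions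
(`exists_le_sum_abs_iterate`). Hence `a_α` decays in that direction of the strip faster than every
`exp (-L * ρ(M) ^ |Re w|)`. The strip `S_m` has width `m / (2π)`, and by Phragmén–Lindelöf a nonzero
holomorphic function on it cannot decay like this once `log ρ(M) > 2π² / m`
(`eq_zero_of_doubly_exponential_decay`). So `a_α = 0` for `α ≠ 0` (`laurentTerm_one_eq_zero`),
`F (w, z) = a_0 (w)` is a function of `w` alone, and being `1`-periodic it descends to the annulus
(`differentiableOn_descend`).

The term `a_α(w) z^α` is encoded as the Fourier coefficient of `F (w, ·)` on the torus through `z`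
(`laurentTerm`). That it is a constant multiple of `z^α` follows from its being holomorphic in
`log z` and equivariant under the compact torus (`laurentTerm_exp`).
-/

namespace FlatBundle

/-! ### Irreducible integral matrices and their spectral radius -/

/-- If the characteristic polynomial of a rational matrix `A` is irreducible, then every nonzero
vector is cyclic for `A`: a nonzero polynomial of degree less than `d` is coprime to the
characteristic polynomial, hence does not kill the vector, and dimensions agree. -/
lemma exists_aeval_mulVec_eq {d : ℕ} (A : Matrix (Fin d) (Fin d) ℚ) (hA : Irreducible A.charpoly)
    {β : Fin d → ℚ} (hβ : β ≠ 0) (γ : Fin d → ℚ) :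
    ∃ p : Polynomial ℚ, (Polynomial.aeval A p).mulVec β = γ := by
  let ev : Polynomial ℚ →ₗ[ℚ] (Fin d → ℚ) :=
    { toFun := fun p => (Polynomial.aeval A p).mulVec β
      map_add' := fun p q => by rw [map_add, Matrix.add_mulVec]
      map_smul' := fun c p => by rw [map_smul, Matrix.smul_mulVec, RingHom.id_apply] }
  have hdeg : A.charpoly.degree = d := by
    rw [Matrix.charpoly_degree_eq_dim, Fintype.card_fin]
  have hinj : Function.Injective (ev ∘ₗ (Polynomial.degreeLT ℚ d).subtype) := by
    rw [← LinearMap.ker_eq_bot, LinearMap.ker_eq_bot']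
    rintro ⟨p, hp⟩ h0
    replace h0 : (Polynomial.aeval A p).mulVec β = 0 := h0
    rw [Polynomial.mem_degreeLT] at hp
    by_contra hne
    have hp0 : p ≠ 0 := fun h => hne (Subtype.ext h)
    have hnd : ¬ A.charpoly ∣ p := fun hdvd =>
      absurd (Polynomial.degree_le_of_dvd hdvd hp0) (by rw [hdeg]; exact not_le.2 hp)
    obtain ⟨a, b, hab⟩ := (EuclideanDomain.dvd_or_coprime _ p hA).resolve_left hnd
    have h1 := congrArg (fun q => (Polynomial.aeval A q).mulVec β) hab
    simp only [map_add, map_mul, Matrix.aeval_self_charpoly, mul_zero, zero_add, map_one,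
      Matrix.one_mulVec, ← Matrix.mulVec_mulVec, h0, Matrix.mulVec_zero] at h1
    exact hβ h1.symm
  have hfin : Module.finrank ℚ (Polynomial.degreeLT ℚ d) = Module.finrank ℚ (Fin d → ℚ) :=
    (Polynomial.degreeLTEquiv ℚ d).finrank_eq
  have : FiniteDimensional ℚ (Polynomial.degreeLT ℚ d) :=
    Module.Finite.equiv (Polynomial.degreeLTEquiv ℚ d).symm
  obtain ⟨p, hp⟩ := (LinearMap.injective_iff_surjective_of_finrank_eq_finrank hfin).1 hinj γ
  exact ⟨p.1, hp⟩

/-- A complex eigenvector of an integral matrix with irreducible characteristic polynomial is not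
orthogonal to any nonzero integral vector. -/
lemma sum_mul_eigenvector_ne_zero {d : ℕ} (M : Matrix (Fin d) (Fin d) ℤ)
    (hirr : Irreducible M.charpoly) {μ : ℂ} {v : Fin d → ℂ} (hv : v ≠ 0)
    (hMv : (M.map (Int.cast : ℤ → ℂ)).mulVec v = μ • v) {α : Fin d → ℤ} (hα : α ≠ 0) :
    ∑ i, (α i : ℂ) * v i ≠ 0 := by
  set A : Matrix (Fin d) (Fin d) ℚ := (M.map (Int.castRingHom ℚ)).transpose with hAdef
  have hA : Irreducible A.charpoly := by
    rw [hAdef, Matrix.charpoly_transpose, Matrix.charpoly_map]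
    have := (Polynomial.Monic.irreducible_iff_irreducible_map_fraction_map (K := ℚ)
      (Matrix.charpoly_monic M)).1 hirr
    simpa using this
  set β : Fin d → ℚ := fun i => (α i : ℚ) with hβdef
  have hβ : β ≠ 0 := fun h => hα (funext fun i => by
    have := congrFun h i
    simpa [hβdef] using this)
  intro h0
  let ψ : (Fin d → ℚ) → ℂ := fun γ => ∑ i, (γ i : ℂ) * v i
  have hψA : ∀ γ, ψ (A.mulVec γ) = μ * ψ γ := by
    intro γ
    have h1 : ∀ k, ∑ i, (M k i : ℂ) * v i = μ * v k := fun k => by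
      simpa [Matrix.mulVec, dotProduct] using congrFun hMv k
    simp only [ψ, Matrix.mulVec, dotProduct, hAdef, Matrix.transpose_apply, Matrix.map_apply]
    push_cast
    simp_rw [Finset.sum_mul, Finset.mul_sum]
    rw [Finset.sum_comm]
    refine Finset.sum_congr rfl fun k _ => ?_
    rw [show μ * ((γ k : ℂ) * v k) = γ k * (μ * v k) by ring, ← h1 k, Finset.mul_sum]
    refine Finset.sum_congr rfl fun i _ => ?_
    simp
    ring
  have hψadd : ∀ γ δ, ψ (γ + δ) = ψ γ + ψ δ := fun γ δ => by
    simp [ψ, add_mul, Finset.sum_add_distrib]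
  have hψsmul : ∀ (c : ℚ) γ, ψ (c • γ) = c * ψ γ := fun c γ => by
    simp [ψ, Finset.mul_sum, mul_assoc]
  have hpow : ∀ (n : ℕ), ψ ((A ^ n).mulVec β) = μ ^ n * ψ β := by
    intro n
    induction n with
    | zero => simp
    | succ n ih => rw [pow_succ', ← Matrix.mulVec_mulVec, hψA, ih]; ring
  have hψp : ∀ p : Polynomial ℚ, ψ ((Polynomial.aeval A p).mulVec β) = 0 := by
    intro p
    induction p using Polynomial.induction_on' with
    | add p q hp hq => rw [map_add, Matrix.add_mulVec, hψadd, hp, hq, add_zero]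
    | monomial n c =>
      rw [Polynomial.aeval_monomial, ← Algebra.smul_def, Matrix.smul_mulVec, hψsmul, hpow]
      have : ψ β = 0 := by simpa [ψ, hβdef] using h0
      rw [this]; simp
  refine hv (funext fun i => ?_)
  obtain ⟨p, hp⟩ := exists_aeval_mulVec_eq A hA hβ (Pi.single i 1)
  have := hψp p
  rw [hp] at this
  change ∑ k, ((Pi.single i (1 : ℚ) : Fin d → ℚ) k : ℂ) * v k = 0 at this
  rw [Finset.sum_eq_single i (fun k _ hk => by simp [hk]) (by simp)] at this
  simpa using this

/-- The spectral radius of a complex matrix is the modulus of an eigenvalue. -/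
lemma exists_eigenvector_norm_eq_spectralRadius {d : ℕ} (hd : 0 < d)
    (A : Matrix (Fin d) (Fin d) ℂ) :
    ∃ (μ : ℂ) (v : Fin d → ℂ), v ≠ 0 ∧ A.mulVec v = μ • v ∧ ‖μ‖ = (spectralRadius ℂ A).toReal := by
  have : Nonempty (Fin d) := ⟨⟨0, hd⟩⟩
  let := Matrix.linftyOpNormedRing (n := Fin d) (α := ℂ)
  let := Matrix.linftyOpNormedAlgebra (n := Fin d) (R := ℂ) (α := ℂ)
  obtain ⟨μ, hμ, hr⟩ := spectrum.exists_nnnorm_eq_spectralRadius A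
  rw [spectrum.mem_iff, Matrix.isUnit_iff_isUnit_det, isUnit_iff_ne_zero, not_not] at hμ
  obtain ⟨v, hv, h0⟩ := Matrix.exists_mulVec_eq_zero_iff.2 hμ
  refine ⟨μ, v, hv, ?_, by rw [← hr]; simp⟩
  rw [Matrix.sub_mulVec, sub_eq_zero, Algebra.algebraMap_eq_smul_one, Matrix.smul_mulVec,
    Matrix.one_mulVec] at h0
  exact h0.symm

/-! ### A Phragmén–Lindelöf theorem in a strip -/

/-- A holomorphic function on the strip `|Im w| < s` that decays faster than every
`exp (-L * exp (κ * Re w))` as `Re w → ∞` vanishes if `κ > π / (2s)`. The map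
`z ↦ (2b/π) log (1 + z)` carries the closed right half-plane into the half-strip
`|Im w| ≤ b`, `Re w ≥ 0`, where the Phragmén–Lindelöf principle for superexponential decay on the
real axis applies. -/
lemma eq_zero_of_doubly_exponential_decay {s κ : ℝ} (hκ : 0 < κ) (hs : Real.pi < 2 * s * κ)
    {h : ℂ → ℂ} (hh : DifferentiableOn ℂ h {w | |w.im| < s})
    (hd : ∀ b < s, ∀ L : ℝ, 0 ≤ L → ∃ C : ℝ, ∀ w : ℂ, |w.im| ≤ b → 0 ≤ w.re →
      ‖h w‖ ≤ C * Real.exp (-(L * Real.exp (κ * w.re)))) :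
    ∀ w : ℂ, |w.im| < s → h w = 0 := by
  have hpi := Real.pi_pos
  -- a closed substrip that is still wide enough
  obtain ⟨b, hb1, hb2⟩ : ∃ b, Real.pi / (2 * κ) < b ∧ b < s := by
    apply exists_between
    rw [div_lt_iff₀ (by positivity)]
    linarith
  have hb0 : 0 < b := lt_trans (by positivity) hb1
  have hs0 : 0 < s := hb0.trans hb2
  have hbκ : 1 ≤ κ * (2 * b / Real.pi) := by
    rw [div_lt_iff₀ (by positivity)] at hb1
    rw [mul_div_assoc', le_div_iff₀ hpi]
    linarith
  set φ : ℂ → ℂ := fun z => ((2 * b / Real.pi : ℝ) : ℂ) * Complex.log (1 + z) with hφ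
  have hφim : ∀ z : ℂ, 0 ≤ z.re → |(φ z).im| ≤ b := by
    intro z hz
    have h1 : |Complex.arg (1 + z)| ≤ Real.pi / 2 :=
      Complex.abs_arg_le_pi_div_two_iff.2 (by simp; linarith)
    simp only [hφ, Complex.im_ofReal_mul, Complex.log_im]
    rw [abs_mul, abs_of_pos (by positivity : 0 < 2 * b / Real.pi)]
    calc 2 * b / Real.pi * |Complex.arg (1 + z)| ≤ 2 * b / Real.pi * (Real.pi / 2) := by gcongr
      _ = b := by field_simp
  have hφre : ∀ z : ℂ, 0 ≤ z.re → 0 ≤ (φ z).re := by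
    intro z hz
    simp only [hφ, Complex.re_ofReal_mul, Complex.log_re]
    refine mul_nonneg (by positivity) (Real.log_nonneg ?_)
    calc (1 : ℝ) ≤ (1 + z).re := by simp; exact hz
      _ ≤ ‖1 + z‖ := Complex.re_le_norm _
  have hopen : IsOpen {w : ℂ | |w.im| < s} := isOpen_lt (by fun_prop) continuous_const
  have hdiff : ∀ z : ℂ, 0 ≤ z.re → DifferentiableAt ℂ (h ∘ φ) z := by
    intro z hz
    have h1 : DifferentiableAt ℂ φ z := by
      refine DifferentiableAt.const_mul (DifferentiableAt.clog (by fun_prop) ?_) _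
      refine Or.inl ?_
      simp; linarith
    exact (hh.differentiableAt (hopen.mem_nhds (lt_of_le_of_lt (hφim z hz) hb2))).comp z h1
  obtain ⟨C, hC⟩ := hd b hb2 0 le_rfl
  have hbound : ∀ z : ℂ, 0 ≤ z.re → ‖(h ∘ φ) z‖ ≤ C := fun z hz => by
    simpa using hC (φ z) (hφim z hz) (hφre z hz)
  have hzero : Set.EqOn (h ∘ φ) 0 {z : ℂ | 0 ≤ z.re} := by
    refine PhragmenLindelof.eq_zero_on_right_half_plane_of_superexponential_decay ?_ ?_ ?_ ?_
    · refine DifferentiableOn.diffContOnCl fun z hz => ?_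
      rw [Complex.closure_setOfPred_lt_re] at hz
      exact (hdiff z hz).differentiableWithinAt
    · refine ⟨1, by norm_num, 0, ?_⟩
      refine Asymptotics.IsBigO.of_bound C ?_
      rw [Filter.eventually_inf_principal]
      refine Filter.Eventually.of_forall fun z hz => ?_
      simpa using hbound z (le_of_lt hz)
    · rw [Asymptotics.superpolynomialDecay_iff_abs_tendsto_zero]
      intro n
      obtain ⟨D, hD⟩ := hd b hb2 (n + 1) (by positivity)
      have hD0 : 0 ≤ D := by
        have := (norm_nonneg _).trans (hD 0 (by simpa using hb0.le) le_rfl)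
        exact nonneg_of_mul_nonneg_left this (Real.exp_pos _)
      have hlim : Filter.Tendsto (fun x : ℝ => D * Real.exp (-x)) Filter.atTop (nhds 0) := by
        simpa using Real.tendsto_exp_neg_atTop_nhds_zero.const_mul D
      refine squeeze_zero' (Filter.Eventually.of_forall fun x => abs_nonneg _) ?_ hlim
      filter_upwards [Filter.eventually_ge_atTop 0] with x hx
      have hx' : (0 : ℝ) ≤ (x : ℂ).re := by simpa using hx
      have h1 := hD (φ x) (hφim x hx') (hφre x hx')
      have h2 : x ≤ Real.exp (κ * (φ x).re) := by
        have h3 : (φ x).re = 2 * b / Real.pi * Real.log (1 + x) := by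
          simp only [hφ, Complex.re_ofReal_mul, Complex.log_re]
          rw [show (1 + x : ℂ) = ((1 + x : ℝ) : ℂ) by push_cast; rfl, Complex.norm_real,
            Real.norm_of_nonneg (by linarith)]
        have h4 : Real.log (1 + x) ≤ κ * (φ x).re := by
          rw [h3, ← mul_assoc]
          exact le_mul_of_one_le_left (Real.log_nonneg (by linarith)) hbκ
        calc x ≤ 1 + x := by linarith
          _ = Real.exp (Real.log (1 + x)) := (Real.exp_log (by linarith)).symm
          _ ≤ _ := Real.exp_le_exp.2 h4
      rw [abs_of_nonneg (by positivity), ← Real.exp_nat_mul]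
      calc Real.exp (n * x) * ‖(h ∘ φ) x‖
          ≤ Real.exp (n * x) * (D * Real.exp (-((n + 1) * x))) := by
            gcongr
            refine h1.trans ?_
            gcongr
        _ = D * Real.exp (-x) := by
            rw [mul_left_comm, ← Real.exp_add]
            ring_nf
    · exact ⟨C, fun x => hbound _ (by simp)⟩
  have hreal : ∀ x : ℝ, 0 ≤ x → h x = 0 := by
    intro x hx
    obtain ⟨y, hy1, hy⟩ : ∃ y : ℝ, 1 ≤ y ∧ 2 * b / Real.pi * Real.log y = x :=
      ⟨Real.exp (x / (2 * b / Real.pi)), Real.one_le_exp (by positivity), by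
        rw [Real.log_exp, mul_div_cancel₀]; positivity⟩
    have h2 := hzero (show ((y - 1 : ℝ) : ℂ) ∈ {z : ℂ | 0 ≤ z.re} by simpa using hy1)
    have h3 : φ ((y - 1 : ℝ) : ℂ) = x := by
      simp only [hφ]
      rw [show (1 : ℂ) + ((y - 1 : ℝ) : ℂ) = (y : ℂ) by push_cast; ring,
        ← Complex.ofReal_log (by linarith), ← Complex.ofReal_mul, hy]
    rw [Function.comp_apply, h3] at h2
    exact h2
  have hconv : Convex ℝ {w : ℂ | |w.im| < s} := by
    have : {w : ℂ | |w.im| < s} = Complex.imLm ⁻¹' (Set.Ioo (-s) s) := by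
      ext w; simp [abs_lt]
    rw [this]
    exact (convex_Ioo _ _).linear_preimage _
  have hfreq : ∃ᶠ z in nhdsWithin (1 : ℂ) {1}ᶜ, h z = 0 := by
    have ht : Filter.Tendsto (fun x : ℝ => (x : ℂ)) (nhdsWithin (1 : ℝ) {1}ᶜ)
        (nhdsWithin (1 : ℂ) {1}ᶜ) := by
      refine tendsto_nhdsWithin_iff.2 ⟨?_, ?_⟩
      · have : Filter.Tendsto (fun x : ℝ => (x : ℂ)) (nhds (1 : ℝ)) (nhds ((1 : ℝ) : ℂ)) :=
          Complex.continuous_ofReal.tendsto 1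
        rw [Complex.ofReal_one] at this
        exact this.mono_left nhdsWithin_le_nhds
      · filter_upwards [self_mem_nhdsWithin] with x hx
        simpa using hx
    refine ht.frequently (Filter.Eventually.frequently ?_)
    filter_upwards [nhdsWithin_le_nhds (Ioi_mem_nhds (zero_lt_one' ℝ))] with x hx
    exact hreal x (le_of_lt hx)
  have := (hh.analyticOnNhd hopen).eqOn_zero_of_preconnected_of_frequently_eq_zero
    hconv.isPreconnected (show (1 : ℂ) ∈ {w : ℂ | |w.im| < s} by simpa using hs0) hfreq
  exact fun w hw => this hw

/-- Let `a α` be holomorphic functions on the strip `|Im w| < s` that are permuted by the unit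
translation, `a α (w + 1) = a (T α) w`, and that decay on `0 ≤ Re w ≤ 1` faster than any exponential
in the size `σ α`. If `σ (T^j α)` grows at least like `exp (κ j)` with `κ > π / (2s)`, then
`a α = 0`. -/
lemma eq_zero_of_translate_eq {ι : Type*} {a : ι → ℂ → ℂ} {T : ι → ι} {σ : ι → ℝ} {s κ : ℝ}
    (hκ : 0 < κ) (hs : Real.pi < 2 * s * κ)
    (ha : ∀ α, DifferentiableOn ℂ (a α) {w | |w.im| < s})
    (hT : ∀ α w, |w.im| < s → a α (w + 1) = a (T α) w)
    (hbd : ∀ b < s, ∀ L : ℝ, 0 ≤ L → ∃ C : ℝ, ∀ α w, w.re ∈ Set.Icc (0 : ℝ) 1 → |w.im| ≤ b →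
      ‖a α w‖ ≤ C * Real.exp (-(L * σ α)))
    {α : ι} {c : ℝ} (hc : 0 < c) (hgrow : ∀ j : ℕ, c * Real.exp (κ * j) ≤ σ (T^[j] α)) :
    ∀ w : ℂ, |w.im| < s → a α w = 0 := by
  have hiter : ∀ (j : ℕ) α w, |w.im| < s → a α (w + j) = a (T^[j] α) w := by
    intro j
    induction j with
    | zero => simp
    | succ j ih =>
      intro α w hw
      rw [Nat.cast_succ, ← add_assoc, hT _ _ (by simpa using hw), ih _ _ hw,
        Function.iterate_succ_apply]
  refine eq_zero_of_doubly_exponential_decay hκ hs (ha α) fun b hb L hL => ?_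
  -- the factor `exp κ` makes up for the rounding of `Re w` to an integer
  obtain ⟨C, hC⟩ := hbd b hb (L * Real.exp κ / c) (by positivity)
  refine ⟨max C 0, fun w hw hre => ?_⟩
  set j := ⌊w.re⌋₊ with hj
  have hj1 : (j : ℝ) ≤ w.re := Nat.floor_le hre
  have hj2 : w.re < j + 1 := Nat.lt_floor_add_one _
  have h1 : a α w = a (T^[j] α) (w - j) := by
    rw [← hiter j α (w - j) (by simpa using lt_of_le_of_lt hw hb), sub_add_cancel]
  have h2 := hC (T^[j] α) (w - j) (by simp; constructor <;> linarith) (by simpa using hw)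
  rw [h1]
  refine h2.trans ?_
  have h3 : L * Real.exp (κ * w.re) ≤ L * Real.exp κ / c * σ (T^[j] α) := by
    calc L * Real.exp (κ * w.re) ≤ L * Real.exp (κ + κ * j) := by
          gcongr
          nlinarith
      _ = L * Real.exp κ / c * (c * Real.exp (κ * j)) := by
          rw [Real.exp_add]; field_simp
      _ ≤ _ := by gcongr; exact hgrow j
  calc C * Real.exp (-(L * Real.exp κ / c * σ (T^[j] α)))
      ≤ max C 0 * Real.exp (-(L * Real.exp κ / c * σ (T^[j] α))) := by
        gcongr; exact le_max_left _ _
    _ ≤ _ := by gcongr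

/-! ### Laurent terms of holomorphic functions on `S_m × (ℂ*)^d` -/

open MeasureTheory in
/-- The integral over a compact space of a jointly continuous family of holomorphic functions of one
variable is holomorphic. -/
lemma differentiableOn_integral_of_continuousOn {X : Type*} [TopologicalSpace X] [CompactSpace X]
    [MeasurableSpace X] [OpensMeasurableSpace X] (μ : Measure X) [IsFiniteMeasure μ]
    {U : Set ℂ} (hU : IsOpen U) {G : ℂ → X → ℂ}
    (hc : ContinuousOn (Function.uncurry G) (U ×ˢ Set.univ))
    (hd : ∀ x, DifferentiableOn ℂ (fun ζ => G ζ x) U) :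
    DifferentiableOn ℂ (fun ζ => ∫ x, G ζ x ∂μ) U := by
  intro ζ₀ hζ₀
  obtain ⟨ε, hε, hεU⟩ := Metric.isOpen_iff.1 hU ζ₀ hζ₀
  set r := ε / 3 with hr
  have hr0 : 0 < r := by positivity
  have hsub : Metric.closedBall ζ₀ (2 * r) ⊆ U :=
    (Metric.closedBall_subset_ball (by linarith)).trans hεU
  have hcont : ∀ ζ ∈ U, Continuous (G ζ) := fun ζ hζ =>
    hc.comp_continuous (f := fun x => (ζ, x)) (by fun_prop) fun x => ⟨hζ, trivial⟩
  obtain ⟨C, hC⟩ :=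
    ((isCompact_closedBall ζ₀ (2 * r)).prod isCompact_univ).exists_bound_of_continuousOn
    (hc.mono (Set.prod_mono hsub subset_rfl))
  have hder : ∀ x, ∀ ζ ∈ U, HasDerivAt (fun ζ => G ζ x) (deriv (fun ζ => G ζ x) ζ) ζ :=
    fun x ζ hζ => ((hd x).differentiableAt (hU.mem_nhds hζ)).hasDerivAt
  have hball : Metric.ball ζ₀ r ⊆ U :=
    ((Metric.ball_subset_ball (by linarith)).trans Metric.ball_subset_closedBall).trans hsub
  refine (hasDerivAt_integral_of_dominated_loc_of_deriv_le (μ := μ) (F := G)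
    (F' := fun ζ x => deriv (fun ζ => G ζ x) ζ) (bound := fun _ => C / r)
    (Metric.ball_mem_nhds ζ₀ hr0) ?_ ?_ ?_ ?_ (integrable_const _)
    ?_).2.differentiableAt.differentiableWithinAt
  · filter_upwards [hU.mem_nhds hζ₀] with ζ hζ
    exact (hcont ζ hζ).aestronglyMeasurable
  · refine Integrable.of_bound (hcont ζ₀ hζ₀).aestronglyMeasurable C
      (Filter.Eventually.of_forall fun x => hC (ζ₀, x) ⟨Metric.mem_closedBall_self (by positivity),
        trivial⟩)
  · -- the derivative is a pointwise limit of difference quotients, which are continuous in `x`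
    have hlim : Filter.Tendsto (fun n : ℕ => ((r / (n + 2) : ℝ) : ℂ)) Filter.atTop
        (nhdsWithin 0 {0}ᶜ) := by
      refine tendsto_nhdsWithin_iff.2 ⟨?_, Filter.Eventually.of_forall fun n => ?_⟩
      · have h1 : Filter.Tendsto (fun n : ℕ => r / ((n : ℝ) + 2)) Filter.atTop (nhds 0) :=
          Filter.Tendsto.div_atTop tendsto_const_nhds
            (Filter.tendsto_atTop_add_const_right _ _ tendsto_natCast_atTop_atTop)
        have h2 := (Complex.continuous_ofReal.tendsto 0).comp h1
        rw [Complex.ofReal_zero] at h2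
        exact h2
      · have : r / ((n : ℝ) + 2) ≠ 0 := by positivity
        simpa only [Set.mem_compl_iff, Set.mem_singleton_iff, Complex.ofReal_eq_zero] using this
    refine aestronglyMeasurable_of_tendsto_ae Filter.atTop (f := fun (n : ℕ) x =>
      ((r / (n + 2) : ℝ) : ℂ)⁻¹ * (G (ζ₀ + ((r / (n + 2) : ℝ) : ℂ)) x - G ζ₀ x)) ?_ ?_
    · intro n
      refine (continuous_const.mul ((hcont _ (hball ?_)).sub (hcont _ hζ₀))).aestronglyMeasurable
      rw [Metric.mem_ball, dist_self_add_left, Complex.norm_real,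
        Real.norm_of_nonneg (by positivity), div_lt_iff₀ (by positivity)]
      have : (0 : ℝ) ≤ n := n.cast_nonneg
      nlinarith
    · exact Filter.Eventually.of_forall fun x => (hder x ζ₀ hζ₀).tendsto_slope_zero.comp hlim
  · refine Filter.Eventually.of_forall fun x ζ hζ => ?_
    have hsub' : Metric.closedBall ζ r ⊆ Metric.closedBall ζ₀ (2 * r) := by
      refine Metric.closedBall_subset_closedBall' ?_
      rw [Metric.mem_ball] at hζ
      linarith
    refine Complex.norm_deriv_le_of_forall_mem_sphere_norm_le hr0 ?_ fun η hη =>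
      hC (η, x) ⟨hsub' (Metric.sphere_subset_closedBall hη), trivial⟩
    refine DifferentiableOn.diffContOnCl ((hd x).mono ?_)
    rw [closure_ball _ hr0.ne']
    exact hsub'.trans hsub
  · exact Filter.Eventually.of_forall fun x ζ hζ => hder x ζ (hball hζ)

/-- The point `(exp (2πi t₁), …, exp (2πi t_d))` of the unit torus in `(ℂ*)^d`. -/
noncomputable def torusPoint {d : ℕ} (t : UnitAddTorus (Fin d)) : Fin d → ℂ := fun i => (t i).toCircle

/-- The endomorphism of the real torus `(ℝ/ℤ)^d` given by an integral matrix. -/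
noncomputable def torusHom {d : ℕ} (A : Matrix (Fin d) (Fin d) ℤ) :
    UnitAddTorus (Fin d) →+ UnitAddTorus (Fin d) where
  toFun t := fun i => ∑ k, A i k • t k
  map_zero' := by ext i; simp
  map_add' t s := by ext i; simp [Finset.sum_add_distrib]

section Torus

variable {d : ℕ}

lemma torusPoint_ne_zero (t : UnitAddTorus (Fin d)) (i : Fin d) : torusPoint t i ≠ 0 :=
  Circle.coe_ne_zero _

lemma norm_torusPoint (t : UnitAddTorus (Fin d)) (i : Fin d) : ‖torusPoint t i‖ = 1 :=
  Circle.norm_coe _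

lemma torusPoint_zero : torusPoint (0 : UnitAddTorus (Fin d)) = 1 := by
  funext i
  simp [torusPoint, AddCircle.toCircle_zero]

lemma torusPoint_add (t s : UnitAddTorus (Fin d)) :
    torusPoint (t + s) = torusPoint t * torusPoint s := by
  funext i
  simp [torusPoint, AddCircle.toCircle_add]

lemma continuous_torusPoint : Continuous (torusPoint : UnitAddTorus (Fin d) → Fin d → ℂ) :=
  continuous_pi fun i => continuous_subtype_val.comp
    (AddCircle.continuous_toCircle.comp (continuous_apply i))

lemma coe_toCircle_sum {ι : Type*} (u : Finset ι) (f : ι → UnitAddCircle) :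
    ((∑ i ∈ u, f i : UnitAddCircle).toCircle : ℂ) = ∏ i ∈ u, ((f i).toCircle : ℂ) := by
  classical
  induction u using Finset.induction_on with
  | empty => simp [AddCircle.toCircle_zero]
  | insert a u ha ih => rw [Finset.sum_insert ha, Finset.prod_insert ha, AddCircle.toCircle_add,
      Circle.coe_mul, ih]

lemma mFourier_apply_eq_toCircle (α : Fin d → ℤ) (t : UnitAddTorus (Fin d)) :
    UnitAddTorus.mFourier α t = ((∑ i, α i • t i : UnitAddCircle).toCircle : ℂ) := by
  rw [coe_toCircle_sum]
  change ∏ i, fourier (α i) (t i) = _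
  simp only [fourier_apply]

lemma mFourier_apply_add (α : Fin d → ℤ) (t s : UnitAddTorus (Fin d)) :
    UnitAddTorus.mFourier α (t + s) = UnitAddTorus.mFourier α t * UnitAddTorus.mFourier α s := by
  simp [mFourier_apply_eq_toCircle, Finset.sum_add_distrib, AddCircle.toCircle_add]

lemma mFourier_torusHom (A : Matrix (Fin d) (Fin d) ℤ) (α : Fin d → ℤ)
    (t : UnitAddTorus (Fin d)) :
    UnitAddTorus.mFourier α (torusHom A t) = UnitAddTorus.mFourier (Matrix.vecMul α A) t := by
  rw [mFourier_apply_eq_toCircle, mFourier_apply_eq_toCircle]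
  congr 2
  change ∑ i, α i • ∑ k, A i k • t k = ∑ k, (∑ i, α i * A i k) • t k
  simp_rw [Finset.smul_sum, Finset.sum_smul, mul_smul]
  exact Finset.sum_comm

lemma torusPoint_torusHom (A : Matrix (Fin d) (Fin d) ℤ) (t : UnitAddTorus (Fin d)) :
    torusPoint (torusHom A t) = monomialMap A (torusPoint t) := by
  funext i
  change ((∑ k, A i k • t k : UnitAddCircle).toCircle : ℂ) = ∏ k, ((t k).toCircle : ℂ) ^ A i k
  rw [coe_toCircle_sum]
  simp only [AddCircle.toCircle_zsmul, Circle.coe_zpow]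

lemma torusHom_mul (A B : Matrix (Fin d) (Fin d) ℤ) (t : UnitAddTorus (Fin d)) :
    torusHom (A * B) t = torusHom A (torusHom B t) := by
  funext i
  change ∑ k, (∑ l, A i l * B l k) • t k = ∑ l, A i l • ∑ k, B l k • t k
  simp_rw [Finset.smul_sum, Finset.sum_smul, mul_smul]
  exact Finset.sum_comm

lemma torusHom_one (t : UnitAddTorus (Fin d)) : torusHom 1 t = t := by
  funext i
  change ∑ k, (1 : Matrix (Fin d) (Fin d) ℤ) i k • t k = t i
  rw [Finset.sum_eq_single i (fun k _ hk => by rw [Matrix.one_apply_ne hk.symm, zero_smul])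
    (by simp), Matrix.one_apply_eq, one_smul]

lemma continuous_torusHom (A : Matrix (Fin d) (Fin d) ℤ) : Continuous (torusHom A) :=
  continuous_pi fun i => continuous_finsetSum Finset.univ fun k _ =>
    (continuous_apply k).zsmul (A i k)

lemma monomialMap_mul_apply (A : Matrix (Fin d) (Fin d) ℤ) (y z : Fin d → ℂ) :
    monomialMap A (y * z) = monomialMap A y * monomialMap A z := by
  funext i
  simp [monomialMap, mul_zpow, Finset.prod_mul_distrib]

/-- The normalized Haar measure on the torus `(ℝ/ℤ)^d`. -/
noncomputable abbrev torusMeasure (d : ℕ) : MeasureTheory.Measure (UnitAddTorus (Fin d)) :=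
  MeasureTheory.Measure.pi fun _ => AddCircle.haarAddCircle

lemma integral_comp_torusHom (M : Matrix.GeneralLinearGroup (Fin d) ℤ)
    (g : UnitAddTorus (Fin d) → ℂ) :
    ∫ t, g (torusHom (M : Matrix (Fin d) (Fin d) ℤ) t) ∂torusMeasure d =
      ∫ t, g t ∂torusMeasure d := by
  have hsurj : Function.Surjective (torusHom (M : Matrix (Fin d) (Fin d) ℤ)) := fun t =>
    ⟨torusHom ((M⁻¹ : Matrix.GeneralLinearGroup (Fin d) ℤ) : Matrix (Fin d) (Fin d) ℤ) t, by
      rw [← torusHom_mul, ← Units.val_mul, mul_inv_cancel, Units.val_one, torusHom_one]⟩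
  have hinj : Function.Injective (torusHom (M : Matrix (Fin d) (Fin d) ℤ)) := by
    refine Function.LeftInverse.injective (g := torusHom
      ((M⁻¹ : Matrix.GeneralLinearGroup (Fin d) ℤ) : Matrix (Fin d) (Fin d) ℤ)) fun t => ?_
    rw [← torusHom_mul, ← Units.val_mul, inv_mul_cancel, Units.val_one, torusHom_one]
  exact (AddMonoidHom.measurePreserving (continuous_torusHom _) hsurj rfl).integral_comp
    ((continuous_torusHom _).isClosedEmbedding hinj).measurableEmbedding g

/-- Polar coordinates on `(ℂ*)^d`. -/
lemma exists_eq_torusPoint_mul_exp {z : Fin d → ℂ} (hz : ∀ i, z i ≠ 0) :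
    ∃ (t : UnitAddTorus (Fin d)) (x : Fin d → ℝ),
      z = torusPoint t * fun i => Complex.exp (x i) := by
  refine ⟨fun i => (((z i).arg / (2 * Real.pi) : ℝ) : UnitAddCircle),
    fun i => Real.log ‖z i‖, ?_⟩
  funext i
  have h1 : 2 * Real.pi / 1 * ((z i).arg / (2 * Real.pi)) = (z i).arg := by
    field_simp
  rw [Pi.mul_apply, torusPoint, AddCircle.toCircle_apply_mk, h1, Circle.coe_exp,
    ← Complex.ofReal_exp, Real.exp_log (norm_pos_iff.2 (hz i)), mul_comm,
    Complex.norm_mul_exp_arg_mul_I]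

end Torus

/-- The term `a_α(w) z^α` of the Laurent expansion of `F(w, ·)`, as the `α`-th Fourier coefficient
of the restriction of `F(w, ·)` to the torus through `z`. -/
noncomputable def laurentTerm {d : ℕ} (F : ℂ × (Fin d → ℂ) → ℂ) (α : Fin d → ℤ) (w : ℂ)
    (z : Fin d → ℂ) : ℂ :=
  UnitAddTorus.mFourierCoeff (fun t => F (w, torusPoint t * z)) α

section Laurent

variable {d : ℕ} {m : ℝ} {F : ℂ × (Fin d → ℂ) → ℂ}

lemma laurentTerm_eq_integral (α : Fin d → ℤ) (w : ℂ) (z : Fin d → ℂ) :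
    laurentTerm F α w z =
      ∫ t, UnitAddTorus.mFourier (-α) t * F (w, torusPoint t * z) ∂torusMeasure d := rfl

lemma laurentTerm_torusPoint_mul (α : Fin d → ℤ) (w : ℂ) (s : UnitAddTorus (Fin d))
    (z : Fin d → ℂ) :
    laurentTerm F α w (torusPoint s * z) = UnitAddTorus.mFourier α s * laurentTerm F α w z := by
  rw [laurentTerm_eq_integral, laurentTerm_eq_integral,
    ← MeasureTheory.integral_add_right_eq_self
      (fun t => UnitAddTorus.mFourier (-α) t * F (w, torusPoint t * z)) s,
    ← MeasureTheory.integral_const_mul]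
  refine MeasureTheory.integral_congr_ae (Filter.Eventually.of_forall fun t => ?_)
  have h1 : UnitAddTorus.mFourier α s * UnitAddTorus.mFourier (-α) s = 1 := by
    rw [← UnitAddTorus.mFourier_add, add_neg_cancel, UnitAddTorus.mFourier_zero,
      ContinuousMap.one_apply]
  simp only [mFourier_apply_add, torusPoint_add]
  rw [mul_assoc (torusPoint t)]
  linear_combination (-UnitAddTorus.mFourier (-α) t * F (w, torusPoint t * (torusPoint s * z))) * h1

/-- If `F` is invariant under `(w, z) ↦ (w + 1, M.z)`, then the Laurent terms of `F` over `w + 1`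
and over `w` are matched by the action of `M` on exponents. -/
lemma laurentTerm_add_one (M : Matrix.GeneralLinearGroup (Fin d) ℤ) (α : Fin d → ℤ) {w : ℂ}
    (hF : ∀ z : Fin d → ℂ, (∀ i, z i ≠ 0) →
      F (w + 1, monomialMap (M : Matrix (Fin d) (Fin d) ℤ) z) = F (w, z))
    {z : Fin d → ℂ} (hz : ∀ i, z i ≠ 0) :
    laurentTerm F α (w + 1) (monomialMap (M : Matrix (Fin d) (Fin d) ℤ) z) =
      laurentTerm F (Matrix.vecMul α (M : Matrix (Fin d) (Fin d) ℤ)) w z := by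
  rw [laurentTerm_eq_integral, laurentTerm_eq_integral, ← integral_comp_torusHom M]
  refine MeasureTheory.integral_congr_ae (Filter.Eventually.of_forall fun t => ?_)
  simp only [mFourier_torusHom, torusPoint_torusHom, Matrix.neg_vecMul, ← monomialMap_mul_apply]
  rw [hF (torusPoint t * z) fun i => mul_ne_zero (torusPoint_ne_zero t i) (hz i)]

/-- A Laurent term is holomorphic along every holomorphic curve in `S_m × (ℂ*)^d`. -/
lemma differentiableOn_laurentTerm_comp (hF : DifferentiableOn ℂ F (stripProd m d)) (α : Fin d → ℤ)
    {U : Set ℂ} (hU : IsOpen U) {w : ℂ → ℂ} {z : ℂ → Fin d → ℂ} (hw : DifferentiableOn ℂ w U)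
    (hz : DifferentiableOn ℂ z U)
    (hmem : ∀ ζ ∈ U, (w ζ, z ζ) ∈ (stripProd m d : Set (ℂ × (Fin d → ℂ)))) :
    DifferentiableOn ℂ (fun ζ => laurentTerm F α (w ζ) (z ζ)) U := by
  have hmem' : ∀ ζ ∈ U, ∀ t, (w ζ, torusPoint t * z ζ) ∈
      (stripProd m d : Set (ℂ × (Fin d → ℂ))) := fun ζ hζ t =>
    ⟨(hmem ζ hζ).1, fun i => mul_ne_zero (torusPoint_ne_zero t i) ((hmem ζ hζ).2 i)⟩
  simp_rw [laurentTerm_eq_integral]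
  refine differentiableOn_integral_of_continuousOn (torusMeasure d) hU ?_ fun t => ?_
  · refine ContinuousOn.mul ?_ (hF.continuousOn.comp ?_ fun p hp => hmem' p.1 hp.1 p.2)
    · exact ((UnitAddTorus.mFourier (-α)).continuous.comp continuous_snd).continuousOn
    · refine ContinuousOn.prodMk (hw.continuousOn.comp continuousOn_fst fun p hp => hp.1) ?_
      exact (continuous_torusPoint.comp continuous_snd).continuousOn.mul
        (hz.continuousOn.comp continuousOn_fst fun p hp => hp.1)
  · refine DifferentiableOn.const_mul (hF.comp ?_ fun ζ hζ => hmem' ζ hζ t) _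
    refine hw.prodMk ?_
    rw [differentiableOn_pi]
    exact fun i => (differentiableOn_pi.1 hz i).const_mul _

/-- An entire function that is invariant under imaginary translations is constant. -/
lemma eq_of_forall_add_mul_I_eq {g : ℂ → ℂ} (hg : Differentiable ℂ g)
    (h : ∀ (ζ : ℂ) (y : ℝ), g (ζ + y * Complex.I) = g ζ) (a b : ℂ) : g a = g b := by
  refine is_const_of_deriv_eq_zero hg (fun ζ => ?_) a b
  have h1 : HasDerivAt (fun y : ℝ => ζ + (y : ℂ) * Complex.I) Complex.I 0 := by
    simpa using ((Complex.ofRealCLM.hasDerivAt (x := (0 : ℝ))).mul_const Complex.I).const_add ζ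
  have h2 : HasDerivAt (fun y : ℝ => g (ζ + (y : ℂ) * Complex.I)) (deriv g ζ * Complex.I) 0 := by
    refine HasDerivAt.comp (h₂ := g) (0 : ℝ) ?_ h1
    simpa using (hg ζ).hasDerivAt
  simp_rw [h] at h2
  have := h2.unique (hasDerivAt_const (0 : ℝ) (g ζ))
  simpa using this

/-- The Laurent coefficient does not depend on the radii of the torus over which it is computed. -/
lemma laurentTerm_exp (hF : DifferentiableOn ℂ F (stripProd m d)) (α : Fin d → ℤ) {w : ℂ}
    (hw : |w.im| < m / (4 * Real.pi)) (x : Fin d → ℝ) :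
    laurentTerm F α w (fun i => Complex.exp (x i)) =
      Complex.exp (∑ i, (α i : ℂ) * x i) * laurentTerm F α w 1 := by
  set g : ℂ → ℂ := fun ζ => Complex.exp (-(ζ * ∑ i, (α i : ℂ) * x i)) *
    laurentTerm F α w (fun i => Complex.exp (ζ * x i)) with hg
  have hgd : Differentiable ℂ g := by
    refine Differentiable.mul (by fun_prop) ?_
    rw [← differentiableOn_univ]
    refine differentiableOn_laurentTerm_comp hF α isOpen_univ (differentiableOn_const w) ?_
      fun ζ _ => ⟨hw, fun i => Complex.exp_ne_zero _⟩
    rw [differentiableOn_pi]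
    exact fun i => by fun_prop
  have hinv : ∀ (ζ : ℂ) (y : ℝ), g (ζ + y * Complex.I) = g ζ := by
    intro ζ y
    set t : UnitAddTorus (Fin d) :=
      fun i => ((y * x i / (2 * Real.pi) : ℝ) : UnitAddCircle) with ht
    have ht' : ∀ i, ((t i).toCircle : ℂ) = Complex.exp (y * Complex.I * x i) := fun i => by
      have h1 : 2 * Real.pi / 1 * (y * x i / (2 * Real.pi)) = y * x i := by field_simp
      simp only [ht]
      rw [AddCircle.toCircle_apply_mk, h1, Circle.coe_exp]
      push_cast
      ring_nf
    have h1 : (fun i => Complex.exp ((ζ + y * Complex.I) * x i)) =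
        torusPoint t * fun i => Complex.exp (ζ * x i) := by
      funext i
      rw [Pi.mul_apply, torusPoint, ht', ← Complex.exp_add]
      ring_nf
    have h2 : UnitAddTorus.mFourier α t =
        Complex.exp (y * Complex.I * ∑ i, (α i : ℂ) * x i) := by
      change ∏ i, fourier (α i) (t i) = _
      rw [Finset.mul_sum, Complex.exp_sum]
      refine Finset.prod_congr rfl fun i _ => ?_
      rw [fourier_apply, AddCircle.toCircle_zsmul, Circle.coe_zpow, ht', ← Complex.exp_int_mul]
      ring_nf
    simp only [hg]
    rw [h1, laurentTerm_torusPoint_mul, h2, ← mul_assoc, ← Complex.exp_add]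
    congr 2
    ring
  have h01 := eq_of_forall_add_mul_I_eq hgd hinv 1 0
  simp only [hg, one_mul, zero_mul, neg_zero, Complex.exp_zero] at h01
  change _ = laurentTerm F α w 1 at h01
  rw [← h01, ← mul_assoc, ← Complex.exp_add, add_neg_cancel, Complex.exp_zero, one_mul]

/-- Laurent coefficients decay faster than every exponential of the size of the exponent, uniformly
for `w` in compact subsets of the strip. -/
lemma exists_norm_laurentTerm_one_le (hF : DifferentiableOn ℂ F (stripProd m d)) {b : ℝ}
    (hb : b < m / (4 * Real.pi)) {L : ℝ} (hL : 0 ≤ L) :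
    ∃ C : ℝ, ∀ (α : Fin d → ℤ) (w : ℂ), |w.re| ≤ 1 → |w.im| ≤ b →
      ‖laurentTerm F α w 1‖ ≤ C * Real.exp (-(L * ∑ i, |(α i : ℝ)|)) := by
  set K : Set (ℂ × (Fin d → ℂ)) :=
    {w : ℂ | |w.re| ≤ 1 ∧ |w.im| ≤ b} ×ˢ
      Set.univ.pi fun _ => {z : ℂ | Real.exp (-L) ≤ ‖z‖ ∧ ‖z‖ ≤ Real.exp L} with hK
  have hKc : IsCompact K := by
    refine IsCompact.prod ?_ (isCompact_univ_pi fun _ => ?_)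
    · have : {w : ℂ | |w.re| ≤ 1 ∧ |w.im| ≤ b} = Set.Icc (-1) 1 ×ℂ Set.Icc (-b) b := by
        ext w
        simp [Complex.mem_reProdIm, abs_le]
      rw [this]
      exact isCompact_Icc.reProdIm isCompact_Icc
    · refine (isCompact_closedBall (0 : ℂ) (Real.exp L)).of_isClosed_subset ?_ fun z hz => by
        simpa using hz.2
      exact (isClosed_le continuous_const continuous_norm).inter
        (isClosed_le continuous_norm continuous_const)
  have hKs : K ⊆ (stripProd m d : Set (ℂ × (Fin d → ℂ))) := fun p hp =>
    ⟨lt_of_le_of_lt hp.1.2 hb, fun i => norm_pos_iff.1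
      (lt_of_lt_of_le (Real.exp_pos _) (hp.2 i trivial).1)⟩
  obtain ⟨C, hC⟩ := hKc.exists_bound_of_continuousOn (hF.continuousOn.mono hKs)
  refine ⟨C, fun α w hw1 hw2 => ?_⟩
  -- the torus of radii `exp (L * sign (α i))` makes the monomial `z ^ α` as large as possible
  set x : Fin d → ℝ := fun i => L * SignType.sign (α i : ℝ) with hx
  have hxL : ∀ i, |x i| ≤ L := fun i => by
    simp only [hx]
    rcases lt_trichotomy (α i : ℝ) 0 with h | h | h <;> simp [h, hL, abs_of_nonneg]
  have h1 := laurentTerm_exp hF α (lt_of_le_of_lt hw2 hb) x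
  have hsum : ∑ i, (α i : ℂ) * x i = ((L * ∑ i, |(α i : ℝ)| : ℝ) : ℂ) := by
    rw [Finset.mul_sum]
    push_cast
    refine Finset.sum_congr rfl fun i _ => ?_
    rw [← self_mul_sign (α i : ℝ)]
    simp only [hx]
    push_cast
    ring
  have h2 : ‖laurentTerm F α w (fun i => Complex.exp (x i))‖ ≤ C := by
    rw [laurentTerm_eq_integral]
    refine (MeasureTheory.norm_integral_le_of_norm_le_const (C := C)
      (Filter.Eventually.of_forall fun t => ?_)).trans (by simp)
    rw [norm_mul, mFourier_apply_eq_toCircle, Circle.norm_coe, one_mul]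
    refine hC _ ⟨⟨hw1, hw2⟩, fun i _ => ?_⟩
    have h3 : ‖(torusPoint t * fun i => Complex.exp (x i)) i‖ = Real.exp (x i) := by
      rw [Pi.mul_apply, norm_mul, norm_torusPoint, one_mul, Complex.norm_exp, Complex.ofReal_re]
    have h4 := abs_le.1 (hxL i)
    simp only [Set.mem_ofPred_eq, h3, Real.exp_le_exp]
    exact h4
  rw [h1, hsum, norm_mul, Complex.norm_exp, Complex.ofReal_re] at h2
  rw [Real.exp_neg, ← div_eq_mul_inv, le_div_iff₀ (Real.exp_pos _), mul_comm]
  exact h2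

lemma exists_laurentTerm_eq_mul (hF : DifferentiableOn ℂ F (stripProd m d)) {w : ℂ}
    (hw : |w.im| < m / (4 * Real.pi)) {z : Fin d → ℂ} (hz : ∀ i, z i ≠ 0) (α : Fin d → ℤ) :
    ∃ c : ℂ, (α = 0 → c = 1) ∧ laurentTerm F α w z = c * laurentTerm F α w 1 := by
  obtain ⟨t, x, rfl⟩ := exists_eq_torusPoint_mul_exp hz
  rw [laurentTerm_torusPoint_mul, laurentTerm_exp hF α hw, ← mul_assoc]
  refine ⟨_, ?_, rfl⟩
  rintro rfl
  simp [UnitAddTorus.mFourier_zero]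

/-- If all Laurent coefficients of `F(w, ·)` with nonzero exponent vanish, then `F(w, ·)` is
constant. -/
lemma eq_of_laurentTerm_eq_zero (hF : DifferentiableOn ℂ F (stripProd m d)) {w : ℂ}
    (hw : |w.im| < m / (4 * Real.pi)) (h0 : ∀ α ≠ 0, laurentTerm F α w 1 = 0)
    {z : Fin d → ℂ} (hz : ∀ i, z i ≠ 0) : F (w, z) = F (w, 1) := by
  have key : ∀ z : Fin d → ℂ, (∀ i, z i ≠ 0) → F (w, z) = laurentTerm F 0 w 1 := by
    intro z hz
    have hcont : Continuous fun t : UnitAddTorus (Fin d) => F (w, torusPoint t * z) := by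
      refine hF.continuousOn.comp_continuous
        (continuous_const.prodMk (continuous_torusPoint.mul continuous_const)) fun t => ?_
      exact ⟨hw, fun i => mul_ne_zero (torusPoint_ne_zero t i) (hz i)⟩
    let f : C(UnitAddTorus (Fin d), ℂ) := ⟨_, hcont⟩
    have hcoeff : ∀ α ≠ 0, UnitAddTorus.mFourierCoeff f α = 0 := fun α hα => by
      obtain ⟨c, -, hc⟩ := exists_laurentTerm_eq_mul hF hw hz α
      rw [h0 α hα, mul_zero] at hc
      exact hc
    have hsum : Summable (UnitAddTorus.mFourierCoeff f) :=
      summable_of_ne_finset_zero (s := {0}) fun α hα => hcoeff α (by simpa using hα)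
    have h1 := UnitAddTorus.hasSum_mFourier_series_apply_of_summable hsum 0
    have h2 := h1.unique (hasSum_single 0 fun α hα => by rw [hcoeff α hα, zero_smul])
    have h3 : f 0 = F (w, z) := by
      change F (w, torusPoint 0 * z) = _
      rw [torusPoint_zero, one_mul]
    obtain ⟨c, hc1, hc⟩ := exists_laurentTerm_eq_mul hF hw hz 0
    rw [hc1 rfl, one_mul] at hc
    rw [← h3, h2, UnitAddTorus.mFourier_zero, ContinuousMap.one_apply, smul_eq_mul, mul_one, ← hc]
    rfl
  rw [key z hz, key 1 fun i => one_ne_zero]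

end Laurent

/-! ### Invariant holomorphic functions on `S_m × (ℂ*)^d` -/

section Invariant

variable {d : ℕ}

/-- If a self-map `T` of `ℤ^d` scales a linear functional `γ ↦ ∑ γᵢ vᵢ` by `μ`, then the
`T`-orbit of every vector outside the kernel of the functional grows at least like `‖μ‖ ^ j`. -/
lemma exists_le_sum_abs_iterate {T : (Fin d → ℤ) → Fin d → ℤ} {v : Fin d → ℂ} {μ : ℂ} {κ : ℝ}
    (hμ : ‖μ‖ = Real.exp κ)
    (hT : ∀ γ, ∑ i, (T γ i : ℂ) * v i = μ * ∑ i, (γ i : ℂ) * v i) {α : Fin d → ℤ}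
    (hα : ∑ i, (α i : ℂ) * v i ≠ 0) :
    ∃ c : ℝ, 0 < c ∧ ∀ j : ℕ, c * Real.exp (κ * j) ≤ ∑ i, |((T^[j] α) i : ℝ)| := by
  set B : ℝ := ∑ i, ‖v i‖ + 1 with hB
  have hB0 : 0 < B := by positivity
  have hle : ∀ γ : Fin d → ℤ, ‖∑ i, (γ i : ℂ) * v i‖ ≤ B * ∑ i, |(γ i : ℝ)| := by
    intro γ
    rw [Finset.mul_sum]
    refine norm_sum_le_of_le _ fun i _ => ?_
    rw [norm_mul, Complex.norm_intCast, mul_comm]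
    refine mul_le_mul_of_nonneg_right ?_ (abs_nonneg _)
    have := Finset.single_le_sum (f := fun i => ‖v i‖) (fun i _ => norm_nonneg _)
      (Finset.mem_univ i)
    linarith
  have hiter : ∀ j : ℕ, ∑ i, ((T^[j] α) i : ℂ) * v i = μ ^ j * ∑ i, (α i : ℂ) * v i := by
    intro j
    induction j with
    | zero => simp
    | succ j ih => rw [Function.iterate_succ_apply', hT, ih]; ring
  refine ⟨‖∑ i, (α i : ℂ) * v i‖ / B, div_pos (norm_pos_iff.2 hα) hB0, fun j => ?_⟩
  have h1 := hle (T^[j] α)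
  rw [hiter, norm_mul, norm_pow, hμ, ← Real.exp_nat_mul] at h1
  rw [div_mul_eq_mul_div, div_le_iff₀ hB0, mul_comm κ, mul_comm ‖_‖, mul_comm _ B]
  exact h1

lemma sum_vecMul_mul (A : Matrix (Fin d) (Fin d) ℤ) {v : Fin d → ℂ} {μ : ℂ}
    (hv : (A.map (Int.cast : ℤ → ℂ)).mulVec v = μ • v) (γ : Fin d → ℤ) :
    ∑ i, ((Matrix.vecMul γ A) i : ℂ) * v i = μ * ∑ i, (γ i : ℂ) * v i := by
  have h1 : ∀ k, ∑ i, (A k i : ℂ) * v i = μ * v k := fun k => by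
    simpa [Matrix.mulVec, dotProduct] using congrFun hv k
  simp only [Matrix.vecMul, dotProduct]
  push_cast
  simp_rw [Finset.sum_mul, Finset.mul_sum]
  rw [Finset.sum_comm]
  refine Finset.sum_congr rfl fun k _ => ?_
  rw [mul_left_comm, ← h1 k, Finset.mul_sum]
  exact Finset.sum_congr rfl fun i _ => mul_assoc _ _ _

lemma monomialMap_apply_one (A : Matrix (Fin d) (Fin d) ℤ) :
    monomialMap A (1 : Fin d → ℂ) = 1 := by
  funext i
  simp [monomialMap]

variable {m : ℝ} {F : ℂ × (Fin d → ℂ) → ℂ}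

/-- The Laurent coefficients with nonzero exponent of an invariant holomorphic function vanish. The
exponent `α` is moved along its orbit under `M` or `M⁻¹`, according to which of the two realizes
`ρ(M)`; irreducibility makes the orbit grow like `ρ(M) ^ j`. -/
lemma laurentTerm_one_eq_zero (hd : 0 < d) (M : Matrix.GeneralLinearGroup (Fin d) ℤ)
    (hρ : 1 < rho M) (hirr : Irreducible (M : Matrix (Fin d) (Fin d) ℤ).charpoly)
    (hmρ : 2 * Real.pi ^ 2 < m * Real.log (rho M))
    (hF : DifferentiableOn ℂ F (stripProd m d))
    (hinv : ∀ x ∈ stripProd m d,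
      F (x.1 + 1, monomialMap (M : Matrix (Fin d) (Fin d) ℤ) x.2) = F x)
    {α : Fin d → ℤ} (hα : α ≠ 0) {w : ℂ} (hw : |w.im| < m / (4 * Real.pi)) :
    laurentTerm F α w 1 = 0 := by
  have hpi := Real.pi_pos
  set κ := Real.log (rho M) with hκdef
  have hκ : 0 < κ := Real.log_pos hρ
  have hexp : Real.exp κ = rho M := Real.exp_log (by linarith)
  have hs : Real.pi < 2 * (m / (4 * Real.pi)) * κ := by
    have : 2 * (m / (4 * Real.pi)) * κ = m * κ / (2 * Real.pi) := by field_simp; ring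
    rw [this, lt_div_iff₀ (by positivity)]
    linarith
  have hstep : ∀ (β : Fin d → ℤ) (u : ℂ), |u.im| < m / (4 * Real.pi) →
      laurentTerm F β (u + 1) 1 =
        laurentTerm F (Matrix.vecMul β (M : Matrix (Fin d) (Fin d) ℤ)) u 1 := fun β u hu => by
    have h := laurentTerm_add_one M β (w := u) (fun z hz => hinv (u, z) ⟨hu, hz⟩)
      (z := 1) fun i => one_ne_zero
    rwa [monomialMap_apply_one] at h
  have hdiff : ∀ β, DifferentiableOn ℂ (fun u => laurentTerm F β u 1)
      {u : ℂ | |u.im| < m / (4 * Real.pi)} := fun β =>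
    differentiableOn_laurentTerm_comp hF β (isOpen_lt (by fun_prop) continuous_const)
      differentiableOn_id (differentiableOn_const _) fun u hu => ⟨hu, fun i => one_ne_zero⟩
  rcases max_choice
    (spectralRadius ℂ ((M : Matrix (Fin d) (Fin d) ℤ).map (Int.cast : ℤ → ℂ))).toReal
    (spectralRadius ℂ (((M⁻¹ : Matrix.GeneralLinearGroup (Fin d) ℤ) :
      Matrix (Fin d) (Fin d) ℤ).map (Int.cast : ℤ → ℂ))).toReal with hmax | hmax
  · obtain ⟨μ, v, hv, hMv, hμ⟩ := exists_eigenvector_norm_eq_spectralRadius hd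
      ((M : Matrix (Fin d) (Fin d) ℤ).map (Int.cast : ℤ → ℂ))
    rw [← hmax] at hμ
    obtain ⟨c, hc, hgrow⟩ := exists_le_sum_abs_iterate (hμ.trans hexp.symm)
      (sum_vecMul_mul (M : Matrix (Fin d) (Fin d) ℤ) hMv)
      (sum_mul_eigenvector_ne_zero _ hirr hv hMv hα)
    refine eq_zero_of_translate_eq (a := fun β u => laurentTerm F β u 1)
      (σ := fun β => ∑ i, |(β i : ℝ)|) hκ hs hdiff hstep
      (fun b hb L hL => ?_) hc hgrow w hw
    obtain ⟨C, hC⟩ := exists_norm_laurentTerm_one_le hF hb hL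
    exact ⟨C, fun β u hu hub => hC β u (abs_le.2 ⟨by linarith [hu.1], hu.2⟩) hub⟩
  · obtain ⟨μ, v, hv, hMv, hμ⟩ := exists_eigenvector_norm_eq_spectralRadius hd
      (((M⁻¹ : Matrix.GeneralLinearGroup (Fin d) ℤ) :
        Matrix (Fin d) (Fin d) ℤ).map (Int.cast : ℤ → ℂ))
    rw [← hmax] at hμ
    have hμ1 : ‖μ‖ = rho M := hμ
    have hμ0 : μ ≠ 0 := norm_pos_iff.1 (by rw [hμ1]; linarith)
    have hMv' : ((M : Matrix (Fin d) (Fin d) ℤ).map (Int.cast : ℤ → ℂ)).mulVec v = μ⁻¹ • v := by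
      have h1 : ((M : Matrix (Fin d) (Fin d) ℤ).map (Int.cast : ℤ → ℂ)) *
          (((M⁻¹ : Matrix.GeneralLinearGroup (Fin d) ℤ) :
            Matrix (Fin d) (Fin d) ℤ).map (Int.cast : ℤ → ℂ)) = 1 := by
        have h2 := congrArg (Int.castRingHom ℂ).mapMatrix M.mul_inv
        rwa [map_mul, map_one] at h2
      have h3 := congrArg (fun u => ((M : Matrix (Fin d) (Fin d) ℤ).map
        (Int.cast : ℤ → ℂ)).mulVec u) hMv
      simp only [Matrix.mulVec_mulVec, h1, Matrix.one_mulVec, Matrix.mulVec_smul] at h3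
      rw [eq_inv_smul_iff₀ hμ0]
      exact h3.symm
    obtain ⟨c, hc, hgrow⟩ := exists_le_sum_abs_iterate (hμ.trans hexp.symm)
      (sum_vecMul_mul ((M⁻¹ : Matrix.GeneralLinearGroup (Fin d) ℤ) :
        Matrix (Fin d) (Fin d) ℤ) hMv)
      (sum_mul_eigenvector_ne_zero _ hirr hv hMv' hα)
    have hmaps : Set.MapsTo (fun u : ℂ => -u) {u : ℂ | |u.im| < m / (4 * Real.pi)}
        {u : ℂ | |u.im| < m / (4 * Real.pi)} := fun u hu => by simpa using hu
    have h := eq_zero_of_translate_eq (a := fun β u => laurentTerm F β (-u) 1)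
      (σ := fun β => ∑ i, |(β i : ℝ)|) hκ hs
      (fun β => (hdiff β).comp differentiableOn_id.neg hmaps) (fun β u hu => ?_)
      (fun b hb L hL => ?_) hc hgrow (-w) (by simpa using hw)
    · simpa using h
    · have h1 := hstep (Matrix.vecMul β ((M⁻¹ : Matrix.GeneralLinearGroup (Fin d) ℤ) :
        Matrix (Fin d) (Fin d) ℤ)) (-(u + 1)) (by simpa using hu)
      rw [Matrix.vecMul_vecMul, M.inv_mul, Matrix.vecMul_one] at h1
      rw [← h1]
      congr 1
      ring
    · obtain ⟨C, hC⟩ := exists_norm_laurentTerm_one_le hF hb hL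
      refine ⟨C, fun β u hu hub => hC β (-u) ?_ (by simpa using hub)⟩
      rw [Complex.neg_re, abs_neg]
      exact abs_le.2 ⟨by linarith [hu.1], hu.2⟩

end Invariant

/-! ### Holomorphic functions on open sets and on the quotient `E_m` -/

open Topology

lemma mdifferentiableAt_iff_comp_chartAt_symm {V X : Type*} [NormedAddCommGroup V]
    [NormedSpace ℂ V] [TopologicalSpace X] [ChartedSpace V X] (f : X → ℂ) (x : X) :
    MDifferentiableAt 𝓘(ℂ, V) 𝓘(ℂ, ℂ) f x ↔
      ContinuousAt f x ∧ DifferentiableAt ℂ (f ∘ (chartAt V x).symm) (chartAt V x x) := by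
  rw [mdifferentiableAt_iff]
  simp only [writtenInExtChartAt, extChartAt, mfld_simps, differentiableWithinAt_univ,
    chartAt_self_eq, Function.id_comp]

lemma mdifferentiableAt_iff_differentiableAt_extend {V : Type*} [NormedAddCommGroup V]
    [NormedSpace ℂ V]
    {U : TopologicalSpace.Opens V} (f : U → ℂ) (x : U) :
    MDifferentiableAt 𝓘(ℂ, V) 𝓘(ℂ, ℂ) f x ↔
      DifferentiableAt ℂ (Function.extend Subtype.val f 0) (x : V) := by
  have hev : f ∘ (chartAt V x).symm =ᶠ[𝓝 (x : V)] Function.extend Subtype.val f 0 := by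
    filter_upwards [(chartAt V x).open_target.mem_nhds (mem_chart_target V x)] with u hu
    have h1 : ((chartAt V x).symm u : V) = u := (chartAt V x).right_inv hu
    conv_rhs => rw [← h1]
    rw [Subtype.val_injective.extend_apply]
    rfl
  rw [← hev.differentiableAt_iff, mdifferentiableAt_iff_comp_chartAt_symm]
  constructor
  · exact fun h => h.2
  · refine fun h => ⟨?_, h⟩
    have h1 : ContinuousAt ((f ∘ (chartAt V x).symm) ∘ chartAt V x) x :=
      ContinuousAt.comp (x := x) (f := chartAt V x) (g := f ∘ (chartAt V x).symm)
        h.continuousAt ((chartAt V x).continuousAt (mem_chart_source V x))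
    refine h1.congr ?_
    filter_upwards [(chartAt V x).open_source.mem_nhds (mem_chart_source V x)] with u hu
    simp [(chartAt V x).left_inv hu]

lemma mdifferentiable_opens_iff {V : Type*} [NormedAddCommGroup V] [NormedSpace ℂ V]
    {U : TopologicalSpace.Opens V} (f : U → ℂ) :
    MDifferentiable 𝓘(ℂ, V) 𝓘(ℂ, ℂ) f ↔
      DifferentiableOn ℂ (Function.extend Subtype.val f 0) (U : Set V) := by
  refine ⟨fun h x hx => ((mdifferentiableAt_iff_differentiableAt_extend f ⟨x, hx⟩).1
    (h _)).differentiableWithinAt, fun h x => (mdifferentiableAt_iff_differentiableAt_extend f x).2 ?_⟩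
  exact h.differentiableAt (U.isOpen.mem_nhds x.2)

section Quotient

variable {d : ℕ} {m : ℝ} {M : Matrix.GeneralLinearGroup (Fin d) ℤ}

/-- The covering map `S_m × (ℂ*)^d → E_m`. -/
noncomputable def toTotal (x : Cover m M) : Total m M := Quotient.mk _ x

lemma toTotal_vadd (j : ℤ) (x : Cover m M) : toTotal (j +ᵥ x) = toTotal x :=
  Quotient.sound ⟨j, rfl⟩

/-- The pullback to `S_m × (ℂ*)^d` of a function on `E_m`, extended by zero to `ℂ × ℂ^d`. -/
noncomputable def pullback (f : Total m M → ℂ) : ℂ × (Fin d → ℂ) → ℂ :=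
  Function.extend (Subtype.val : stripProd m d → _) (fun x => f (toTotal (M := M) x)) 0

lemma pullback_apply (f : Total m M → ℂ) (x : Cover m M) : pullback f x.1 = f (toTotal x) :=
  Subtype.val_injective.extend_apply _ _ (x : stripProd m d)

/-- The preferred charts of `E_m` are local inverses of the covering map. -/
lemma exists_chartAt_total_eq (q : Total m M) :
    ∃ a : Cover m M, toTotal a = q ∧ chartAt (ℂ × (Fin d → ℂ)) q q = a.1 ∧
      ∀ᶠ u in 𝓝 a.1, ∃ y : Cover m M, y.1 = u ∧
        (chartAt (ℂ × (Fin d → ℂ)) q).symm u = toTotal y := by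
  have hf : IsLocalHomeomorph (Quotient.mk (AddAction.orbitRel ℤ (Cover m M))) :=
    (isAddQuotientCoveringMap_quotientMk_of_properlyDiscontinuousVAdd (E := Cover m M)
      (G := ℤ)).isCoveringMap.isLocalHomeomorph
  have hsurj : Function.Surjective (Quotient.mk (AddAction.orbitRel ℤ (Cover m M))) :=
    Quotient.mk_surjective
  set a : Cover m M := hsurj.hasRightInverse.choose q with ha
  have haq : Quotient.mk _ a = q := hsurj.hasRightInverse.choose_spec q
  have hchart : chartAt (ℂ × (Fin d → ℂ)) q =
      (hf.localInverseAt a).trans (chartAt (ℂ × (Fin d → ℂ)) a) := rfl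
  refine ⟨a, haq, ?_, ?_⟩
  · have h1 : hf.localInverseAt a q = a := by
      rw [← haq]
      exact hf.localInverseAt_apply_self
    rw [hchart, OpenPartialHomeomorph.coe_trans, Function.comp_apply, h1]
    rfl
  · filter_upwards [(chartAt (ℂ × (Fin d → ℂ)) a).open_target.mem_nhds
      (mem_chart_target (ℂ × (Fin d → ℂ)) a)] with u hu
    refine ⟨(chartAt (ℂ × (Fin d → ℂ)) a).symm u,
      (chartAt (ℂ × (Fin d → ℂ)) a).right_inv hu, ?_⟩
    rw [hchart, OpenPartialHomeomorph.trans_symm_eq_symm_trans_symm,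
      OpenPartialHomeomorph.coe_trans, hf.localInverseAt_symm]
    rfl

lemma pullback_vadd (f : Total m M → ℂ) (j : ℤ) (x : Cover m M) :
    pullback f (x.1.1 + j, monomialMap
      ((M ^ j : Matrix.GeneralLinearGroup (Fin d) ℤ) : Matrix (Fin d) (Fin d) ℤ) x.1.2) =
      pullback f x.1 := by
  exact (pullback_apply f (j +ᵥ x)).trans
    ((congrArg f (toTotal_vadd j x)).trans (pullback_apply f x).symm)

/-- Holomorphic functions on `E_m` are the functions with holomorphic pullback to
`S_m × (ℂ*)^d`. -/
lemma mdifferentiable_total_iff (f : Total m M → ℂ) :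
    MDifferentiable 𝓘(ℂ, ℂ × (Fin d → ℂ)) 𝓘(ℂ, ℂ) f ↔
      DifferentiableOn ℂ (pullback f) (stripProd m d : Set (ℂ × (Fin d → ℂ))) := by
  have hev : ∀ (q : Total m M) (a : Cover m M), (∀ᶠ u in 𝓝 a.1, ∃ y : Cover m M, y.1 = u ∧
        (chartAt (ℂ × (Fin d → ℂ)) q).symm u = toTotal y) →
      (f ∘ (chartAt (ℂ × (Fin d → ℂ)) q).symm) =ᶠ[𝓝 a.1] pullback f := by
    intro q a h
    filter_upwards [h] with u hu
    obtain ⟨y, rfl, hy⟩ := hu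
    rw [Function.comp_apply, hy, pullback_apply]
  constructor
  · intro h x hx
    let x' : Cover m M := ⟨x, hx⟩
    obtain ⟨a, haq, hchart, hsymm⟩ := exists_chartAt_total_eq (toTotal x')
    have h1 := (mdifferentiableAt_iff_comp_chartAt_symm _ _).1 (h (toTotal x'))
    rw [hchart, (hev _ a hsymm).differentiableAt_iff] at h1
    obtain ⟨j, hj⟩ : ∃ j : ℤ, j +ᵥ x' = a := Quotient.exact haq
    have hja : a.1 = (x.1 + (j : ℂ), monomialMap
        ((M ^ j : Matrix.GeneralLinearGroup (Fin d) ℤ) : Matrix (Fin d) (Fin d) ℤ) x.2) := by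
      rw [← hj]
      rfl
    have h2 := h1.2
    rw [hja] at h2
    have h3 := DifferentiableAt.comp (g := pullback f) x h2
      ((contDiffAt_translate_monomialMap (j : ℂ) _ hx.2).differentiableAt (by simp))
    refine (h3.congr_of_eventuallyEq ?_).differentiableWithinAt
    filter_upwards [(stripProd m d).isOpen.mem_nhds hx] with y hy
    exact (pullback_vadd f j (⟨y, hy⟩ : Cover m M)).symm
  · intro h q
    obtain ⟨a, haq, hchart, hsymm⟩ := exists_chartAt_total_eq q
    rw [mdifferentiableAt_iff_comp_chartAt_symm, hchart, (hev _ a hsymm).differentiableAt_iff]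
    refine ⟨?_, h.differentiableAt ((stripProd m d).isOpen.mem_nhds a.2)⟩
    refine Continuous.continuousAt ?_
    have h1 : Continuous fun x : Cover m M => f (toTotal x) := by
      have h2 := h.continuousOn.comp_continuous (continuous_val (m := m) (M := M)) fun x => x.2
      exact h2.congr fun x => pullback_apply f x
    exact isQuotientMap_quot_mk.continuous_iff.2 h1

end Quotient

/-! ### Descent to the annulus -/

section Descent

open Topology

variable {d : ℕ} {m : ℝ} {M : Matrix.GeneralLinearGroup (Fin d) ℤ}

/-- The universal covering `w ↦ exp (m/2 + 2πiw)` of the annulus, as a function on `ℂ`. -/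
noncomputable def stripExp (m : ℝ) (w : ℂ) : ℂ :=
  Complex.exp (m / 2 + 2 * Real.pi * Complex.I * w)

/-- A section of `stripExp m` over `ℂ \ {0}`, discontinuous along the negative real axis. -/
noncomputable def stripLog (m : ℝ) (v : ℂ) : ℂ :=
  (Complex.log v - m / 2) / (2 * Real.pi * Complex.I)

lemma stripExp_stripLog {v : ℂ} (hv : v ≠ 0) : stripExp m (stripLog m v) = v := by
  rw [stripExp, stripLog, mul_div_cancel₀ _ Complex.two_pi_I_ne_zero, add_sub_cancel,
    Complex.exp_log hv]

lemma ne_zero_of_mem_annulus {v : ℂ} (hv : v ∈ annulus m) : v ≠ 0 :=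
  norm_pos_iff.1 (zero_lt_one.trans hv.1)

lemma abs_im_stripLog_lt {v : ℂ} (hv : v ∈ annulus m) :
    |(stripLog m v).im| < m / (4 * Real.pi) := by
  have hpi := Real.pi_pos
  have h1 : (stripLog m v).im = -(Real.log ‖v‖ - m / 2) / (2 * Real.pi) := by
    have h2 : stripLog m v = ((-(1 / (2 * Real.pi)) : ℝ) : ℂ) *
        ((Complex.log v - ((m / 2 : ℝ) : ℂ)) * Complex.I) := by
      rw [stripLog]
      push_cast
      field_simp
      rw [Complex.I_sq]
      ring
    rw [h2, Complex.im_ofReal_mul, Complex.mul_I_im, Complex.sub_re, Complex.log_re,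
      Complex.ofReal_re]
    ring
  have h3 : 0 < Real.log ‖v‖ := Real.log_pos hv.1
  have h4 : Real.log ‖v‖ < m := by
    rw [Real.log_lt_iff_lt_exp (by linarith [hv.1])]
    exact hv.2
  have h5 : m / (4 * Real.pi) = (m / 2) / (2 * Real.pi) := by field_simp; ring
  rw [h1, abs_div, abs_of_pos (by positivity : 0 < 2 * Real.pi), h5, abs_neg]
  gcongr
  rw [abs_lt]
  constructor <;> linarith

/-- The function on the annulus induced by the restriction of a function on `E_m` to the section
`z = 1`. -/
noncomputable def descend (f : Total m M → ℂ) (v : ℂ) : ℂ := pullback f (stripLog m v, 1)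

lemma descend_stripExp (f : Total m M → ℂ) {w : ℂ} (hw : |w.im| < m / (4 * Real.pi)) :
    descend f (stripExp m w) = pullback f (w, 1) := by
  have h := stripExp_stripLog (m := m) (v := stripExp m w) (Complex.exp_ne_zero _)
  unfold stripExp at h
  rw [Complex.exp_eq_exp_iff_exists_int] at h
  obtain ⟨n, hn⟩ := h
  have h1 : stripLog m (stripExp m w) = w + n := by
    have h2 : 2 * Real.pi * Complex.I * (stripLog m (stripExp m w) - (w + n)) = 0 := by
      unfold stripExp
      linear_combination hn
    exact sub_eq_zero.1 ((mul_eq_zero.1 h2).resolve_left Complex.two_pi_I_ne_zero)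
  have h3 := pullback_vadd f n (⟨(w, 1), hw, fun _ => one_ne_zero⟩ : Cover m M)
  rw [descend, h1, ← monomialMap_apply_one
    ((M ^ n : Matrix.GeneralLinearGroup (Fin d) ℤ) : Matrix (Fin d) (Fin d) ℤ)]
  exact h3.trans (by rw [monomialMap_apply_one])

lemma differentiableOn_descend {f : Total m M → ℂ}
    (hf : DifferentiableOn ℂ (pullback f) (stripProd m d : Set (ℂ × (Fin d → ℂ)))) :
    DifferentiableOn ℂ (descend f) (annulus m : Set ℂ) := by
  intro v₀ hv₀
  have hv₀' := ne_zero_of_mem_annulus hv₀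
  -- a holomorphic section of `stripExp m` near `v₀`
  set σ : ℂ → ℂ := fun v => stripLog m v₀ + Complex.log (v / v₀) / (2 * Real.pi * Complex.I)
    with hσ
  have hσ₀ : σ v₀ = stripLog m v₀ := by simp [hσ, div_self hv₀']
  have hσd : DifferentiableAt ℂ σ v₀ := by
    refine DifferentiableAt.const_add _ (DifferentiableAt.div_const ?_ _)
    refine DifferentiableAt.clog (by fun_prop) ?_
    rw [div_self hv₀']
    exact Complex.one_mem_slitPlane
  have hσexp : ∀ v ≠ 0, stripExp m (σ v) = v := fun v hv => by
    have h1 : (m / 2 + 2 * Real.pi * Complex.I * σ v : ℂ) =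
        (m / 2 + 2 * Real.pi * Complex.I * stripLog m v₀) + Complex.log (v / v₀) := by
      simp only [hσ]
      rw [mul_add, mul_div_cancel₀ _ Complex.two_pi_I_ne_zero, add_assoc]
    have h2 := stripExp_stripLog (m := m) hv₀'
    rw [stripExp] at h2 ⊢
    rw [h1, Complex.exp_add, h2, Complex.exp_log (div_ne_zero hv hv₀'), mul_div_cancel₀ _ hv₀']
  have hmem : (σ v₀, (1 : Fin d → ℂ)) ∈ (stripProd m d : Set (ℂ × (Fin d → ℂ))) := by
    rw [hσ₀]
    exact ⟨abs_im_stripLog_lt hv₀, fun _ => one_ne_zero⟩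
  have hcomp : DifferentiableAt ℂ (fun v => pullback f (σ v, 1)) v₀ :=
    DifferentiableAt.comp (g := pullback f) v₀
      (hf.differentiableAt ((stripProd m d).isOpen.mem_nhds hmem))
      (hσd.prodMk (differentiableAt_const _))
  refine (hcomp.congr_of_eventuallyEq ?_).differentiableWithinAt
  have hcont : ContinuousAt (fun v => (σ v, (1 : Fin d → ℂ))) v₀ :=
    hσd.continuousAt.prodMk continuousAt_const
  filter_upwards [hcont.eventually ((stripProd m d).isOpen.mem_nhds hmem),
    isOpen_ne.mem_nhds hv₀'] with v hv hv0
  rw [← descend_stripExp f hv.1, hσexp v hv0]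

/-- Pulling back along `p` preserves holomorphy. -/
lemma mdifferentiable_comp_proj {g : annulus m → ℂ} (hg : MDifferentiable 𝓘(ℂ, ℂ) 𝓘(ℂ, ℂ) g) :
    MDifferentiable 𝓘(ℂ, ℂ × (Fin d → ℂ)) 𝓘(ℂ, ℂ) fun x : Total m M => g (proj m M x) := by
  rw [mdifferentiable_total_iff]
  have hg' := (mdifferentiable_opens_iff g).1 hg
  have hmaps : Set.MapsTo (fun x : ℂ × (Fin d → ℂ) => stripExp m x.1) (stripProd m d)
      (annulus m) := fun x hx => (coverProj m M (⟨x, hx⟩ : Cover m M)).2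
  refine (hg'.comp (Differentiable.differentiableOn ?_) hmaps).congr fun x hx => ?_
  · unfold stripExp
    fun_prop
  · refine (pullback_apply _ (⟨x, hx⟩ : Cover m M)).trans ?_
    exact (Subtype.val_injective.extend_apply g 0 (coverProj m M (⟨x, hx⟩ : Cover m M))).symm

lemma proj_surjective : Function.Surjective (proj m M) := fun v =>
  ⟨toTotal (⟨(stripLog m v, 1), abs_im_stripLog_lt v.2, fun _ => one_ne_zero⟩ : Cover m M),
    Subtype.ext (stripExp_stripLog (ne_zero_of_mem_annulus v.2))⟩

/-- The homomorphism `g ↦ g ∘ p` from `𝒪(A_m)` to `𝒪(E_m)`. -/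
noncomputable def pullbackHom (m : ℝ) (M : Matrix.GeneralLinearGroup (Fin d) ℤ) :
    holomorphicFunctions ℂ (annulus m) →ₐ[ℂ]
      holomorphicFunctions (ℂ × (Fin d → ℂ)) (Total m M) where
  toFun g := ⟨fun x => g.1 (proj m M x), mdifferentiable_comp_proj g.2⟩
  map_one' := rfl
  map_mul' _ _ := rfl
  map_zero' := rfl
  map_add' _ _ := rfl
  commutes' _ := rfl

end Descent

end FlatBundle

theorem theorem2 (d : ℕ) (hd : 2 ≤ d) (M : Matrix.GeneralLinearGroup (Fin d) ℤ)
    (hρ : 1 < FlatBundle.rho M) (m : ℝ) (hm : 0 < m)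
    (hirr : Irreducible (M : Matrix (Fin d) (Fin d) ℤ).charpoly)
    (hmρ : 2 * Real.pi ^ 2 < m * Real.log (FlatBundle.rho M)) :
    ∃ Φ : FlatBundle.holomorphicFunctions ℂ (FlatBundle.annulus m) ≃ₐ[ℂ]
        FlatBundle.holomorphicFunctions (ℂ × (Fin d → ℂ)) (FlatBundle.Total m M),
      ∀ (g : FlatBundle.holomorphicFunctions ℂ (FlatBundle.annulus m))
        (x : FlatBundle.Total m M), (Φ g).1 x = g.1 (FlatBundle.proj m M x) := by
  open FlatBundle in
  refine ⟨AlgEquiv.ofBijective (pullbackHom m M) ⟨fun g₁ g₂ h => ?_, fun f => ?_⟩,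
    fun g x => rfl⟩
  · refine Subtype.ext (funext fun v => ?_)
    obtain ⟨x, rfl⟩ := proj_surjective (M := M) v
    exact congrFun (congrArg Subtype.val h) x
  · have hF := (mdifferentiable_total_iff f.1).1 f.2
    have hinv : ∀ x ∈ stripProd m d,
        pullback f.1 (x.1 + 1, monomialMap (M : Matrix (Fin d) (Fin d) ℤ) x.2) =
          pullback f.1 x := fun x hx => by
      have h := pullback_vadd f.1 1 (⟨x, hx⟩ : Cover m M)
      rw [zpow_one, Int.cast_one] at h
      exact h
    have hfib : ∀ x ∈ stripProd m d, pullback f.1 x = pullback f.1 (x.1, 1) := fun x hx =>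
      eq_of_laurentTerm_eq_zero hF hx.1
        (fun α hα => laurentTerm_one_eq_zero (by omega) M hρ hirr hmρ hF hinv hα hx.1) hx.2
    refine ⟨⟨fun v => descend f.1 v, ?_⟩, Subtype.ext (funext fun q => ?_)⟩
    · refine (mdifferentiable_opens_iff _).2 ((differentiableOn_descend hF).congr fun v hv => ?_)
      exact Subtype.val_injective.extend_apply _ _ (⟨v, hv⟩ : annulus m)
    · obtain ⟨x, rfl⟩ : ∃ x : Cover m M, toTotal x = q := Quotient.mk_surjective q
      change descend f.1 (stripExp m x.1.1) = f.1 (toTotal x)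
      rw [descend_stripExp f.1 x.2.1]
      exact (hfib x.1 x.2).symm.trans (pullback_apply f.1 x)
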